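/- Linear orders are non-empty. Let $\mathsf{Lin}\subseteq 2^{\mathbb N\times\mathbb N}$ be the space, with the subspace topology, of all linear orders $\leq_K$ on a non-empty subset $K$ of $\mathbb N$. Let $\mathsf{WO}\subseteq\mathsf{Lin}$ be the set of well-orders. A linear order $M$ is strongly surjective if for every linear order $L$ that embeds in $M$ there is an order-preserving surjection from $M$ onto $L$; let $\mathsf{StS}\subseteq\mathsf{Lin}$ be the set of strongly surjective orders. Let $\check{\mathrm D}_2(\mathbf\Pi^1_1)$ be the class of all sets that are the union of an analytic and a coanalytic set. A subset $S$ of a topological space $Y$ is hard for this class if for every zero-dimensional Polish space $X$ and every $\check{\mathrm D}_2(\mathbf\Pi^1_1)$ set $B\subseteq X$ there is a continuous $f\colon X\to Y$ with $f^{-1}(S)=B$. For a linear order $K$, let $\mathbb Z^K$ be the set of maps $\varphi\colon K\to\mathbb Z$ of finite support, where $\varphi<\psi$ if and only if $\varphi(k_0)<\psi(k_0)$ for the largest $k_0$ with $\varphi(k_0)\neq\psi(k_0)$. The product $KL$ of linear orders is the sum over $L$ of copies of $K$. Sums, products, $1$, $\omega$ and the power $K\mapsto\zeta^K$ are realized in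 $\mathsf{Lin}$ by a fixed coding, where $\zeta^K$ is coded by extending the elements of $\mathbb Z^K$ by zero to finitely supported maps $\mathbb N\to\mathbb Z$ and enumerating the latter. Theorem. The set $\mathsf{StS}$ is hard for $\check{\mathrm D}_2(\mathbf\Pi^1_1)$. More precisely, let $A=\{(K,L)\in\mathsf{Lin}\times\mathsf{Lin}\mid K\notin\mathsf{WO}\text{ or }L\in\mathsf{WO}\}$. Then $A$ is hard for $\check{\mathrm D}_2(\mathbf\Pi^1_1)$; for all $K,L\in\mathsf{Lin}$ one has $\zeta^K\cong\mathbb Z^K$, and $f(K,L)=\zeta^K(1+L)\omega$ has order type $\mathbb Z^K(1+L)\omega$; the map $f\colon\mathsf{Lin}\times\mathsf{Lin}\to\mathsf{Lin}$ is continuous; and $f^{-1}(\mathsf{StS})=A$. -/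

import Mathlib

universe u v

/-- The countable linear orders coded as points of `2^(ℕ × ℕ)`: a code is (the characteristic
function of) the non-strict order relation of a linear order on a non-empty subset of `ℕ`.
The subset is `{n | r (n, n) = true}`. -/
structure IsLinCode (r : ℕ × ℕ → Bool) : Prop where
  nonempty : ∃ n, r (n, n) = true
  mem_left : ∀ a b, r (a, b) = true → r (a, a) = true
  mem_right : ∀ a b, r (a, b) = true → r (b, b) = true
  antisymm : ∀ a b, r (a, b) = true → r (b, a) = true → a = b
  trans : ∀ a b c, r (a, b) = true → r (b, c) = true → r (a, c) = true
  total : ∀ a b, r (a, a) = true → r (b, b) = true → r (a, b) = true ∨ r (b, a) = true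

/-- The space of (non-empty) linear orders on subsets of `ℕ`. -/
def Lin : Type := {r : ℕ × ℕ → Bool // IsLinCode r}

namespace Lin

/-- The topology is inherited from the product space `2^(ℕ × ℕ)`. -/
instance : TopologicalSpace Lin := inferInstanceAs (TopologicalSpace {r // IsLinCode r})

/-- The domain of a coded linear order. -/
def Carrier (K : Lin) : Type := {n : ℕ // K.1 (n, n) = true}

instance (K : Lin) : Nonempty K.Carrier := by
  obtain ⟨n, hn⟩ := K.2.nonempty
  exact ⟨⟨n, hn⟩⟩

/-- The coded linear order, on its domain. -/
noncomputable instance (K : Lin) : LinearOrder K.Carrier where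
  le a b := K.1 (a.1, b.1) = true
  le_refl a := a.2
  le_trans a b c := K.2.trans a.1 b.1 c.1
  le_antisymm a b h h' := Subtype.ext (K.2.antisymm a.1 b.1 h h')
  le_total a b := K.2.total a.1 b.1 a.2 b.2
  toDecidableLE := Classical.decRel _

theorem le_iff {K : Lin} (a b : K.Carrier) : a ≤ b ↔ K.1 (a.1, b.1) = true := Iff.rfl

open scoped Classical in
/-- Transport of a non-empty linear order along an injection `e` into `ℕ`: the isomorphic linear
order whose domain is the range of `e`. -/
noncomputable def ofInjective {α : Type} [LinearOrder α] [Nonempty α] (e : α → ℕ)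
    (he : Function.Injective e) : Lin :=
  ⟨fun p => decide (∃ a b : α, e a = p.1 ∧ e b = p.2 ∧ a ≤ b), by
    have key : ∀ a b : α, (∃ a' b' : α, e a' = e a ∧ e b' = e b ∧ a' ≤ b') ↔ a ≤ b := by
      intro a b
      constructor
      · rintro ⟨a', b', ha, hb, h⟩
        rwa [he ha, he hb] at h
      · intro h
        exact ⟨a, b, rfl, rfl, h⟩
    constructor
    · obtain ⟨a⟩ := ‹Nonempty α›
      exact ⟨e a, decide_eq_true ⟨a, a, rfl, rfl, le_refl a⟩⟩
    · intro m n h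
      obtain ⟨a, b, rfl, rfl, h⟩ := of_decide_eq_true h
      exact decide_eq_true ⟨a, a, rfl, rfl, le_refl a⟩
    · intro m n h
      obtain ⟨a, b, rfl, rfl, h⟩ := of_decide_eq_true h
      exact decide_eq_true ⟨b, b, rfl, rfl, le_refl b⟩
    · intro m n h h'
      obtain ⟨a, b, rfl, rfl, hab⟩ := of_decide_eq_true h
      rw [le_antisymm hab ((key b a).1 (of_decide_eq_true h'))]
    · intro m n k h h'
      obtain ⟨a, b, rfl, rfl, hab⟩ := of_decide_eq_true h
      obtain ⟨b', c, hb, rfl, hbc⟩ := of_decide_eq_true h'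
      rw [he hb] at hbc
      exact decide_eq_true ⟨a, c, rfl, rfl, hab.trans hbc⟩
    · intro m n h h'
      obtain ⟨a, -, rfl, -, -⟩ := of_decide_eq_true h
      obtain ⟨b, -, rfl, -, -⟩ := of_decide_eq_true h'
      rcases le_total a b with hab | hab
      · exact Or.inl (decide_eq_true ⟨a, b, rfl, rfl, hab⟩)
      · exact Or.inr (decide_eq_true ⟨b, a, rfl, rfl, hab⟩)⟩

/-- The one-point order, with domain `{0}`. -/
noncomputable def one : Lin :=
  ofInjective (fun _ : Unit => 0) (fun _ _ _ => rfl)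

/-- The order `ω`, that is `ℕ` with its usual order. -/
noncomputable def omega : Lin :=
  ofInjective (fun n : ℕ => n) Function.injective_id

/-- The code in `ℕ` of an element of a sum: even numbers for the first summand, odd numbers for
the second one. -/
def addCode (K L : Lin) (x : K.Carrier ⊕ₗ L.Carrier) : ℕ :=
  Sum.elim (fun k : K.Carrier => 2 * k.1) (fun l : L.Carrier => 2 * l.1 + 1) (ofLex x)

theorem addCode_injective (K L : Lin) : Function.Injective (addCode K L) := by
  intro x y h
  apply ofLex.injective
  revert h
  unfold addCode
  generalize ofLex x = x'
  generalize ofLex y = y'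
  rcases x' with k | l <;> rcases y' with k' | l' <;> simp only [Sum.elim_inl, Sum.elim_inr] <;>
    intro h
  · exact congrArg Sum.inl (Subtype.ext (by omega))
  · omega
  · omega
  · exact congrArg Sum.inr (Subtype.ext (by omega))

/-- The sum `K + L`: every element of `K` precedes every element of `L`. -/
noncomputable def add (K L : Lin) : Lin :=
  haveI : Nonempty (K.Carrier ⊕ₗ L.Carrier) :=
    (inferInstance : Nonempty K.Carrier).map fun k => toLex (Sum.inl k)
  ofInjective (addCode K L) (addCode_injective K L)

/-- The code in `ℕ` of an element of a product. -/
def mulCode (K L : Lin) (x : L.Carrier ×ₗ K.Carrier) : ℕ :=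
  Nat.pair (ofLex x).2.1 (ofLex x).1.1

theorem mulCode_injective (K L : Lin) : Function.Injective (mulCode K L) := by
  intro x y h
  obtain ⟨h1, h2⟩ := Nat.pair_eq_pair.1 h
  exact ofLex.injective (Prod.ext (Subtype.ext h2) (Subtype.ext h1))

/-- The product `K L`, that is, the sum over `L` of copies of `K` (the coordinate in `L` is
compared first). -/
noncomputable def mul (K L : Lin) : Lin :=
  haveI : Nonempty (L.Carrier ×ₗ K.Carrier) :=
    (inferInstance : Nonempty (L.Carrier × K.Carrier)).map toLex
  ofInjective (mulCode K L) (mulCode_injective K L)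

end Lin

/-- The power `ℤ^K` of a linear order `K`: the maps `φ : K → ℤ` of finite support, with
`φ < ψ` if and only if `φ k < ψ k` for the largest `k` such that `φ k ≠ ψ k`. -/
abbrev IntPow (K : Type) : Type := Colex (K →₀ ℤ)

namespace Lin

/-- The code in `ℕ` of a finitely supported map `φ : K → ℤ`: extend `φ` by zero to a finitely
supported map `ℕ → ℤ`, and use a fixed enumeration of these, which does not depend on `K`. -/
noncomputable def zetaCode (K : Lin) (φ : IntPow K.Carrier) : ℕ :=
  Encodable.encode
    (Finsupp.embDomain (⟨Subtype.val, Subtype.val_injective⟩ : K.Carrier ↪ ℕ) (ofColex φ))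

theorem zetaCode_injective (K : Lin) : Function.Injective (zetaCode K) := by
  intro φ ψ h
  exact ofColex.injective (Finsupp.embDomain_injective _ (Encodable.encode_injective h))

/-- The power `ζ^K` as an element of `Lin`. -/
noncomputable def zetaPow (K : Lin) : Lin :=
  haveI : Nonempty (IntPow K.Carrier) := ⟨toColex 0⟩
  ofInjective (zetaCode K) (zetaCode_injective K)

/-- The map `(K, L) ↦ ζ^K (1 + L) ω`. -/
noncomputable def reduction (p : Lin × Lin) : Lin :=
  ((zetaPow p.1).mul (one.add p.2)).mul omega

/-- The set of well-orders in `Lin`. -/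
def WO : Set Lin := {K | WellFoundedLT K.Carrier}

end Lin

/-- A linear order `M` is strongly surjective if every non-empty linear order that embeds into `M`
is the image of `M` under an order-preserving map. A non-empty order that embeds into `M` is
isomorphic to one in the universe of `M`, so the quantifier over that universe is no
restriction. -/
def StronglySurjective (M : Type u) [LinearOrder M] : Prop :=
  ∀ (L : Type u) [LinearOrder L] [Nonempty L], Nonempty (L ↪o M) →
    ∃ g : M → L, Monotone g ∧ Function.Surjective g

/-- The set of countable strongly surjective linear orders. -/
def Lin.StS : Set Lin := {K | StronglySurjective K.Carrier}

/-- The class `Ď₂(Π¹₁)`: unions of an analytic and a coanalytic set. -/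
def IsAnalyticUnionCoanalytic {X : Type*} [TopologicalSpace X] (B : Set X) : Prop :=
  ∃ B₀ B₁ : Set X, MeasureTheory.AnalyticSet B₀ ∧ MeasureTheory.AnalyticSet B₁ᶜ ∧ B = B₀ ∪ B₁

/-- `S ⊆ Y` is hard for the class of unions of an analytic and a coanalytic set: every set of that
class in a zero-dimensional Polish space `X` is a continuous preimage of `S`. -/
def IsHardForAnalyticUnionCoanalytic {Y : Type v} [TopologicalSpace Y] (S : Set Y) : Prop :=
  ∀ (X : Type u) [TopologicalSpace X] [PolishSpace X],
    TopologicalSpace.IsTopologicalBasis {U : Set X | IsClopen U} →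
    ∀ B : Set X, IsAnalyticUnionCoanalytic B → ∃ f : X → Y, Continuous f ∧ f ⁻¹' S = B

/-! Write `M = ℤ^K (1 + L) ω`. If `K` is ill-founded, its non-accessible points form a final segment
`P` without a least element. Then `ℤ^P` is dense without endpoints, and restriction to `P` maps `M`
onto the countable dense order `ℤ^P (1 + L) ω`, which by Cantor's theorem maps onto every countable
order (`StronglySurjective.of_dense_image`).

If `K` is well-founded, `ℤ^K` is strongly surjective by induction on `K`. Since it is an ordered
group, it suffices to cover suborders with endpoints (`StronglySurjective.of_bounded`). Such a
suborder embeds in `ℤ^{<k} ω` for some `k`, and collapsing the copies it meets to an initial segment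
covers it (`exists_monotone_of_embedding_wellOrder_prod`). If `L` is well-founded too, `M` is a
well-ordered sum of copies of `ℤ^K`, and the factor `ω` leaves room to treat a suborder slice by
slice along a cofinal sequence (`StronglySurjective.nat_prod`).

If `K` is well-founded and `L` is not, `ℤ^K ω*` embeds in `M`. In a surjection of `M` onto it, the
first copy of `ℤ^K` in `M`, provided by the summand `1`, would cover all sufficiently low copies.
Then `ℤ^K` would embed in a bounded part of itself, which `IntPow.not_strictMono_bounded` excludes.

Hardness of `A` is the classical reduction of analytic sets to ill-founded trees, turned into orders
by Kleene–Brouwer. The map `f` is continuous because each entry of its value depends on finitely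
many entries of the arguments. -/

/-! ### Well-ordered sums of copies of a strongly surjective order -/

theorem StronglySurjective.of_orderIso {M M' : Type u} [LinearOrder M] [LinearOrder M']
    (e : M ≃o M') (h : StronglySurjective M) : StronglySurjective M' := by
  intro L _ _ ⟨j⟩
  obtain ⟨g, hg, hs⟩ := h L ⟨j.trans e.symm.toOrderEmbedding⟩
  exact ⟨g ∘ e.symm, hg.comp e.symm.monotone, hs.comp e.symm.surjective⟩

theorem exists_monotone_cofinal_seq (N : Type u) [LinearOrder N] [Nonempty N] [Countable N] :
    ∃ b : ℕ → N, Monotone b ∧ ∀ x, ∃ n, x ≤ b n := by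
  obtain ⟨e, he⟩ := exists_surjective_nat N
  refine ⟨partialSups e, (partialSups e).monotone, fun x => ?_⟩
  obtain ⟨n, rfl⟩ := he x
  exact ⟨n, le_partialSups e n⟩

/-- A suborder with a greatest element of a well-ordered sum of copies of a strongly surjective
order is an image of that sum, and it is already covered by an initial part of it. -/
theorem exists_monotone_of_embedding_wellOrder_prod {W A : Type} [LinearOrder W] [WellFoundedLT W]
    [LinearOrder A] (hA : StronglySurjective A) (N : Type) [LinearOrder N]
    (j : N ↪o W ×ₗ A) (T : N) (hT : ∀ y, y ≤ T) :
    ∃ h : W ×ₗ A → N, Monotone h ∧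
      ∀ y, ∃ x, h x = y ∧ (ofLex x).1 ≤ (ofLex (j T)).1 := by
  classical
  let I : Type := {w : W // ∃ y, (ofLex (j y)).1 = w}
  let emb : ((· < ·) : I → I → Prop) ↪r ((· < ·) : W → W → Prop) := Subtype.relEmbedding _ _
  -- The copies of `A` that meet the image of `N` are moved down to an initial segment of `W`. No
  -- copy moves up, which gives the bound in the conclusion.
  let ι := emb.collapse
  have hι : ∀ i : I, ι i ≤ i.1 := by
    intro i
    induction i using WellFoundedLT.induction with
    | ind i ih =>
      by_contra! hlt
      obtain ⟨i', hi'⟩ := ι.mem_range_of_rel hlt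
      have hlt' : i' < i := ι.map_rel_iff.1 (hi' ▸ hlt)
      exact absurd (hi'.symm.le.trans (ih i' hlt')) (not_le.2 hlt')
  have hr : ∀ i : I, ∃ r : A → {y // (ofLex (j y)).1 = i.1}, Monotone r ∧ Function.Surjective r := by
    intro i
    have : Nonempty {y // (ofLex (j y)).1 = i.1} := let ⟨y, hy⟩ := i.2; ⟨⟨y, hy⟩⟩
    refine hA _ ⟨OrderEmbedding.ofStrictMono (fun y => (ofLex (j y.1)).2) fun y z hyz => ?_⟩
    have := j.strictMono (show y.1 < z.1 from hyz)
    rw [Prod.Lex.lt_iff, y.2, z.2] at this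
    exact (this.resolve_left (lt_irrefl _)).2
  choose r hrm hrs using hr
  -- Copies beyond the collapsed ones are sent to the greatest element, which keeps the map
  -- monotone.
  let h : W ×ₗ A → N := fun x =>
    if hx : ∃ i, ι i = (ofLex x).1 then (r hx.choose (ofLex x).2).1 else T
  have h_eq : ∀ i a, h (toLex (ι i, a)) = (r i a).1 := by
    intro i a
    have hx : ∃ i', ι i' = ι i := ⟨i, rfl⟩
    have hi : hx.choose = i := ι.injective hx.choose_spec
    change (if hx : ∃ i', ι i' = ι i then (r hx.choose a).1 else T) = _
    rw [dif_pos hx, hi]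
  have h_T : ∀ w a, (¬ ∃ i, ι i = w) → h (toLex (w, a)) = T := fun w a hw => dif_neg hw
  refine ⟨h, ?_, fun y => ?_⟩
  · intro x y hxy
    obtain ⟨w, a⟩ := x
    obtain ⟨w', a'⟩ := y
    change h (toLex (w, a)) ≤ h (toLex (w', a'))
    by_cases hw' : ∃ i, ι i = w'
    · obtain ⟨i', rfl⟩ := hw'
      rcases Prod.Lex.toLex_le_toLex.1 hxy with hlt | ⟨heq, hle⟩
      · obtain ⟨i, rfl⟩ := ι.mem_range_of_rel hlt
        have hlt' : i < i' := ι.map_rel_iff.1 hlt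
        rw [h_eq, h_eq]
        refine le_of_lt (j.lt_iff_lt.1 (Prod.Lex.lt_iff.2 (Or.inl ?_)))
        rw [(r i a).2, (r i' a').2]
        exact hlt'
      · change w = ι i' at heq
        subst heq
        rw [h_eq, h_eq]
        exact hrm i' hle
    · rw [h_T w' a' hw']
      exact hT _
  · let i : I := ⟨(ofLex (j y)).1, y, rfl⟩
    obtain ⟨a, ha⟩ := hrs i ⟨y, rfl⟩
    exact ⟨toLex (ι i, a), by rw [h_eq, ha],
      (hι i).trans (Prod.Lex.monotone_fst _ _ (j.monotone (hT y)))⟩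

theorem exists_block {t : ℕ → ℕ} (ht : StrictMono t) (h0 : t 0 = 0) (i : ℕ) :
    ∃ n, t n ≤ i ∧ i < t (n + 1) := by
  have hex : ∃ n, i < t n := ⟨i + 1, lt_of_lt_of_le (Nat.lt_succ_self i) ht.le_apply⟩
  classical
  obtain ⟨n, hn⟩ : ∃ n, Nat.find hex = n + 1 := by
    refine Nat.exists_eq_succ_of_ne_zero fun h => ?_
    have := Nat.find_spec hex
    rw [h, h0] at this
    exact absurd this (Nat.not_lt_zero i)
  refine ⟨n, not_lt.1 (Nat.find_min hex (by omega)), ?_⟩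
  rw [← hn]
  exact Nat.find_spec hex

/-- Makes the index of the block containing a point both monotone and unique, for blocks indexed by
`ℕ` or by `ℤ`. -/
theorem block_le_of_le {ι M : Type*} [LinearOrder ι] [SuccOrder ι] [LinearOrder M] {t : ι → M}
    (ht : Monotone t) {i i' : M} (hi : i ≤ i') {n m : ι} (hn : t n ≤ i)
    (hm : i' < t (Order.succ m)) : n ≤ m := by
  by_contra! h
  exact absurd ((ht (Order.succ_le_of_lt h)).trans (hn.trans hi)) (not_le.2 hm)

/-- A cofinal sequence cuts the suborder into slices with greatest elements. Each slice needs only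
finitely many of the `ω` copies of `C ×ₗ A`, so the maps for the slices can be laid out one after
another. -/
theorem StronglySurjective.nat_prod {A C : Type} [LinearOrder A] [LinearOrder C]
    [WellFoundedLT C] [Countable A] [Countable C] (hA : StronglySurjective A) :
    StronglySurjective ((ℕ ×ₗ C) ×ₗ A) := by
  intro N _ _ ⟨j⟩
  have : Countable ((ℕ ×ₗ C) ×ₗ A) := inferInstanceAs (Countable ((ℕ × C) × A))
  have : Countable N := j.injective.countable
  obtain ⟨b, hb, hbc⟩ := exists_monotone_cofinal_seq N
  -- Neighbouring slices may share an endpoint; this does no harm, as only weak monotonicity is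
  -- required.
  let S : ℕ → Set N := fun n => {y | (∀ m < n, b m ≤ y) ∧ y ≤ b n}
  let p : ℕ → ℕ := fun n => (ofLex (ofLex (j (b n))).1).1
  have key : ∀ n, ∃ h : (ℕ ×ₗ C) ×ₗ A → N, Monotone h ∧ (∀ x, h x ∈ S n) ∧
      ∀ y ∈ S n, ∃ x, h x = y ∧ (ofLex (ofLex x).1).1 ≤ p n := by
    intro n
    obtain ⟨h, hm, hs⟩ := exists_monotone_of_embedding_wellOrder_prod hA (S n)
      ((OrderEmbedding.subtype (· ∈ S n)).trans j)
      ⟨b n, fun m hm => hb hm.le, le_rfl⟩ (fun y => y.2.2)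
    refine ⟨fun x => (h x).1, fun x y hxy => hm hxy, fun x => (h x).2, fun y hy => ?_⟩
    obtain ⟨x, hx, hle⟩ := hs ⟨y, hy⟩
    exact ⟨x, congrArg Subtype.val hx, Prod.Lex.monotone_fst _ _ hle⟩
  choose h hm hS hs using key
  -- Slice `n` is covered from the copies `0, …, p n`, so it receives `p n + 1` consecutive copies,
  -- starting at `t n`.
  let t : ℕ → ℕ := fun n => ∑ i ∈ Finset.range n, (p i + 1)
  have ht_succ : ∀ n, t (n + 1) = t n + (p n + 1) := fun n => Finset.sum_range_succ _ n
  have ht : StrictMono t := strictMono_nat_of_lt_succ fun n => by rw [ht_succ]; omega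
  choose idx hidx using exists_block ht rfl
  have idx_mono : Monotone idx := fun i i' hi =>
    block_le_of_le ht.monotone hi (hidx i).1 (hidx i').2
  have idx_eq : ∀ i n, t n ≤ i → i < t (n + 1) → idx i = n := fun i n h1 h2 =>
    le_antisymm (block_le_of_le ht.monotone le_rfl (hidx i).1 h2)
      (block_le_of_le ht.monotone le_rfl h1 (hidx i).2)
  let F : (ℕ ×ₗ C) ×ₗ A → N := fun x =>
    let i := (ofLex (ofLex x).1).1
    h (idx i) (toLex (toLex (i - t (idx i), (ofLex (ofLex x).1).2), (ofLex x).2))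
  refine ⟨F, ?_, fun y => ?_⟩
  · rintro ⟨⟨i, c⟩, a⟩ ⟨⟨i', c'⟩, a'⟩ hle
    change h (idx i) (toLex (toLex (i - t (idx i), c), a)) ≤
      h (idx i') (toLex (toLex (i' - t (idx i'), c'), a'))
    have hle' : toLex (toLex (i, c), a) ≤ toLex (toLex (i', c'), a') := hle
    have hii : i ≤ i' := Prod.Lex.monotone_fst _ _ (Prod.Lex.monotone_fst _ _ hle')
    rcases (idx_mono hii).lt_or_eq with hlt | heq
    · exact (hS _ _).2.trans ((hS (idx i') _).1 _ hlt)
    · rw [← heq]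
      apply hm
      have h1 := (hidx i).1
      have h2 := (hidx i').1
      rw [← heq] at h2
      simp only [Prod.Lex.toLex_le_toLex, Prod.Lex.toLex_lt_toLex, toLex_inj, Prod.mk.injEq] at hle' ⊢
      rcases hle' with (h3 | ⟨h3, h4⟩) | ⟨⟨h3, h4⟩, h5⟩
      · left; left; omega
      · left; right; exact ⟨by omega, h4⟩
      · right; exact ⟨⟨by omega, h4⟩, h5⟩
  · have hex := hbc y
    classical
    let n := Nat.find hex
    have hy : y ∈ S n := ⟨fun m hm => (not_le.1 (Nat.find_min hex hm)).le, Nat.find_spec hex⟩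
    obtain ⟨⟨⟨i, c⟩, a⟩, hx, hle⟩ := hs n y hy
    change i ≤ p n at hle
    have hidx' : idx (t n + i) = n := idx_eq _ _ (Nat.le_add_right _ _) (by rw [ht_succ]; omega)
    refine ⟨toLex (toLex (t n + i, c), a), ?_⟩
    change h (idx (t n + i)) (toLex (toLex (t n + i - t (idx (t n + i)), c), a)) = y
    rw [hidx', Nat.add_sub_cancel_left]
    exact hx

/-! ### Restriction and splitting in `ℤ^K` -/

namespace IntPow

variable {K : Type}

instance [Countable K] : Countable (IntPow K) := inferInstanceAs (Countable (K →₀ ℤ))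

/-- The restriction of a finitely supported map to the points that satisfy `p`. -/
noncomputable def restrict (p : K → Prop) (x : IntPow K) : IntPow {k // p k} :=
  toColex (Finsupp.subtypeDomain p (ofColex x))

@[simp]
theorem restrict_apply (p : K → Prop) (x : IntPow K) (k : {k // p k}) :
    ofColex (restrict p x) k = ofColex x k := rfl

theorem restrict_surjective (p : K → Prop) : Function.Surjective (restrict p) := by
  classical
  intro a
  exact ⟨toColex (Finsupp.extendDomain (ofColex a)),
    congrArg toColex (Finsupp.subtypeDomain_extendDomain _)⟩

variable [LinearOrder K]

theorem lt_iff {x y : IntPow K} :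
    x < y ↔ ∃ i, (∀ j, i < j → ofColex x j = ofColex y j) ∧ ofColex x i < ofColex y i := Iff.rfl

/-- The largest point of difference either lies in the final segment and still decides, or lies
outside it, and then the restrictions agree. -/
theorem restrict_monotone {p : K → Prop} (hp : ∀ i j, i ≤ j → p i → p j) :
    Monotone (restrict p) := by
  intro x y hxy
  rcases hxy.eq_or_lt with rfl | hlt
  · exact le_rfl
  · obtain ⟨i, hi, hlt⟩ := lt_iff.1 hlt
    by_cases hpi : p i
    · exact le_of_lt (lt_iff.2 ⟨⟨i, hpi⟩, fun j hj => hi j hj, hlt⟩)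
    · refine le_of_eq (ofColex.injective (Finsupp.ext fun j => hi j ?_))
      exact not_le.1 fun hji => hpi (hp _ _ hji j.2)

/-- The three parts of a finitely supported map: above `k`, at `k` and below `k`. -/
noncomputable def splitFun (k : K) (x : IntPow K) : IntPow {j // k < j} ×ₗ (ℤ ×ₗ IntPow {j // j < k}) :=
  toLex (restrict (k < ·) x, toLex (ofColex x k, restrict (· < k) x))

theorem splitFun_strictMono (k : K) : StrictMono (splitFun k) := by
  intro x y hxy
  obtain ⟨i, hi, hlt⟩ := lt_iff.1 hxy
  rcases lt_trichotomy k i with h | rfl | h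
  · exact Prod.Lex.toLex_lt_toLex.2 (Or.inl (lt_iff.2 ⟨⟨i, h⟩, fun j hj => hi j hj, hlt⟩))
  · exact Prod.Lex.toLex_lt_toLex.2 (Or.inr
      ⟨ofColex.injective (Finsupp.ext fun j => hi j j.2), Prod.Lex.toLex_lt_toLex.2 (Or.inl hlt)⟩)
  · exact Prod.Lex.toLex_lt_toLex.2 (Or.inr
      ⟨ofColex.injective (Finsupp.ext fun j => hi j (h.trans j.2)),
        Prod.Lex.toLex_lt_toLex.2 (Or.inr ⟨hi k h, lt_iff.2 ⟨⟨i, h⟩, fun j hj => hi j hj, hlt⟩⟩)⟩)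

theorem splitFun_surjective (k : K) : Function.Surjective (splitFun k) := by
  classical
  rintro ⟨u, z, a⟩
  refine ⟨toColex (Finsupp.extendDomain (ofColex u) + Finsupp.single k z +
    Finsupp.extendDomain (ofColex a)), ?_⟩
  refine congrArg toLex (Prod.ext ?_ (congrArg toLex (Prod.ext ?_ ?_)))
  · refine ofColex.injective (Finsupp.ext fun j => ?_)
    simp [Finsupp.extendDomain_apply, j.2, j.2.not_gt, j.2.ne']
  · simp [Finsupp.extendDomain_apply]
  · refine ofColex.injective (Finsupp.ext fun j => ?_)
    simp [Finsupp.extendDomain_apply, j.2, j.2.not_gt, j.2.ne]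

/-- The decomposition of `ℤ^K` at a point of `K`. -/
noncomputable def split (k : K) :
    IntPow K ≃o IntPow {j // k < j} ×ₗ (ℤ ×ₗ IntPow {j // j < k}) :=
  (splitFun_strictMono k).orderIsoOfSurjective _ (splitFun_surjective k)

theorem split_apply (k : K) (x : IntPow K) :
    split k x = toLex (restrict (k < ·) x, toLex (ofColex x k, restrict (· < k) x)) := rfl

/-- In `ℤ^K`, an interval `[x, y]` lies in finitely many blocks at the largest point where `x` and
`y` differ. -/
theorem exists_split_of_lt {x y : IntPow K} (h : x < y) :
    ∃ (k : K) (w : IntPow {j // k < j}), ofColex x k < ofColex y k ∧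
      ∀ z, x ≤ z → z ≤ y → restrict (k < ·) z = w ∧ ofColex x k ≤ ofColex z k ∧
        ofColex z k ≤ ofColex y k := by
  obtain ⟨k, hk, hlt⟩ := lt_iff.1 h
  have hxy : restrict (k < ·) x = restrict (k < ·) y :=
    ofColex.injective (Finsupp.ext fun j => hk j j.2)
  have hm := restrict_monotone (p := (k < ·)) fun i j hij hi => lt_of_lt_of_le hi hij
  refine ⟨k, restrict (k < ·) x, hlt, fun z hxz hzy => ?_⟩
  have hz : restrict (k < ·) z = restrict (k < ·) x :=
    le_antisymm ((hm hzy).trans_eq hxy.symm) (hm hxz)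
  have h1 := (split k).monotone hxz
  have h2 := (split k).monotone hzy
  rw [split_apply, split_apply, Prod.Lex.toLex_le_toLex'] at h1 h2
  refine ⟨hz, ?_, ?_⟩
  · exact (Prod.Lex.toLex_le_toLex'.1 (h1.2 hz.symm)).1
  · exact (Prod.Lex.toLex_le_toLex'.1 (h2.2 (hz.trans hxy))).1

end IntPow

/-! ### Countable ordered groups: reduction to suborders with endpoints -/

theorem exists_int_seq_of_step {G : Type*} [AddCommGroup G] (D : ℤ → G) :
    ∃ c : ℤ → G, c 0 = 0 ∧ ∀ z, c (z + 1) = c z + D z := by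
  refine ⟨fun z => ∑ i ∈ Finset.range z.toNat, D i -
    ∑ i ∈ Finset.range (-z).toNat, D (-(i : ℤ) - 1), by simp, fun z => ?_⟩
  rcases le_or_gt 0 z with h | h
  · lift z to ℕ using h
    have h1 : ((z : ℤ) + 1).toNat = z + 1 := by omega
    have h2 : (-((z : ℤ) + 1)).toNat = 0 := by omega
    have h3 : (-(z : ℤ)).toNat = 0 := by omega
    simp only [h1, h2, h3, Finset.sum_range_succ, Int.toNat_natCast, Finset.sum_range_zero, sub_zero]
  · obtain ⟨n, rfl⟩ : ∃ n : ℕ, z = -(n : ℤ) - 1 := ⟨(-z - 1).toNat, by omega⟩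
    have h1 : (-(n : ℤ) - 1 + 1).toNat = 0 := by omega
    have h2 : (-(n : ℤ) - 1).toNat = 0 := by omega
    have h3 : (-(-(n : ℤ) - 1)).toNat = n + 1 := by omega
    have h4 : (-(-(n : ℤ) - 1 + 1)).toNat = n := by omega
    simp only [h1, h2, h3, h4, Finset.sum_range_succ, Finset.sum_range_zero, zero_sub]
    abel

theorem exists_int_block {M : Type*} [LinearOrder M] {c : ℤ → M} (hc : Monotone c)
    (h1 : ∀ x, ∃ z, x < c z) (h2 : ∀ x, ∃ z, c z ≤ x) (x : M) :
    ∃ z, c z ≤ x ∧ x < c (z + 1) := by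
  obtain ⟨z1, hz1⟩ := h1 x
  obtain ⟨z, hz, hmax⟩ := Int.exists_greatest_of_bdd (P := fun z => c z ≤ x)
    ⟨z1, fun z hz => (hc.reflect_lt (lt_of_le_of_lt hz hz1)).le⟩ (h2 x)
  exact ⟨z, hz, not_le.1 fun h => absurd (hmax _ h) (by omega)⟩

theorem exists_monotone_int_seq (N : Type u) [LinearOrder N] [Nonempty N] [Countable N] :
    ∃ b : ℤ → N, Monotone b ∧ (∀ x, ∃ z, x ≤ b z) ∧ ∀ x, ∃ z, b z ≤ x := by
  obtain ⟨b, hb, hbc⟩ := exists_monotone_cofinal_seq N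
  have : Countable Nᵒᵈ := ‹Countable N›
  obtain ⟨b', hb', hbc'⟩ := exists_monotone_cofinal_seq Nᵒᵈ
  obtain ⟨y⟩ := ‹Nonempty N›
  let d : ℕ → N := fun n => OrderDual.ofDual (b' n)
  have hd : Antitone d := fun m n h => hb' h
  -- The maximum and minimum with `y` make the increasing and the decreasing half fit together at
  -- `0`.
  refine ⟨fun z => if 0 ≤ z then max y (b z.toNat) else min y (d (-z).toNat), ?_, fun x => ?_,
    fun x => ?_⟩
  · intro z z' hz
    dsimp only
    split_ifs with h1 h2 h2
    · exact max_le_max le_rfl (hb (by omega))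
    · omega
    · exact (min_le_left _ _).trans (le_max_left _ _)
    · exact min_le_min le_rfl (hd (by omega))
  · obtain ⟨n, hn⟩ := hbc x
    exact ⟨n, by simpa using Or.inr hn⟩
  · obtain ⟨n, hn⟩ := hbc' (OrderDual.toDual x)
    refine ⟨-(n : ℤ) - 1, ?_⟩
    dsimp only
    rw [if_neg (by omega)]
    exact (min_le_right _ _).trans ((hd (by omega)).trans hn)

/-- If all suborders with endpoints of a countable ordered group are images of the group, then so
are all non-empty suborders. -/
theorem StronglySurjective.of_bounded {G : Type} [AddCommGroup G] [LinearOrder G]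
    [IsOrderedAddMonoid G] [Countable G]
    (H : ∀ (N : Type) [LinearOrder N] [BoundedOrder N], Nonempty (N ↪o G) →
      ∃ g : G → N, Monotone g ∧ Function.Surjective g) : StronglySurjective G := by
  intro N _ _ ⟨j⟩
  have : Countable N := j.injective.countable
  rcases subsingleton_or_nontrivial G with hG | hG
  · have := j.injective.subsingleton
    obtain ⟨y⟩ := ‹Nonempty N›
    exact ⟨fun _ => y, monotone_const, fun z => ⟨0, Subsingleton.elim _ _⟩⟩
  obtain ⟨e, he⟩ := exists_zero_lt (α := G)
  obtain ⟨b, hb, hb1, hb2⟩ := exists_monotone_int_seq N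
  have key : ∀ n : ℤ, ∃ h : G → N, Monotone h ∧ (∀ x, b n ≤ h x ∧ h x ≤ b (n + 1)) ∧
      ∀ y, b n ≤ y → y ≤ b (n + 1) → ∃ x, h x = y := by
    intro n
    have hle : b n ≤ b (n + 1) := hb (by omega)
    have : Fact (b n ≤ b (n + 1)) := ⟨hle⟩
    obtain ⟨g, hg, hs⟩ := H (Set.Icc (b n) (b (n + 1)))
      ⟨(OrderEmbedding.subtype (· ∈ Set.Icc (b n) (b (n + 1)))).trans j⟩
    refine ⟨fun x => (g x).1, fun x y hxy => hg hxy, fun x => (g x).2, fun y h1 h2 => ?_⟩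
    obtain ⟨x, hx⟩ := hs ⟨y, h1, h2⟩
    exact ⟨x, congrArg Subtype.val hx⟩
  choose h hm hS hs using key
  -- Only the part of `G` between `l n` and `v n` is needed to cover the `n`-th interval. These
  -- parts are translated and laid out side by side in `G`.
  choose l hl using fun n => hs n (b n) le_rfl (hb (by omega))
  choose v hv using fun n => hs n (b (n + 1)) (hb (by omega)) le_rfl
  obtain ⟨g, hg⟩ := exists_surjective_nat G
  -- The step exceeds `v z - l z`, so that the needed part fits. The terms in the enumeration `g` of
  -- `G` make `c` unbounded in both directions, and `e` makes the inequalities strict.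
  obtain ⟨c, hc0, hc⟩ := exists_int_seq_of_step
    fun z : ℤ => |v z - l z| + |g z.toNat| + |g (-z - 1).toNat| + e
  have hstep : ∀ z, v z - l z < c (z + 1) - c z ∧ g z.toNat < c (z + 1) - c z ∧
      -g (-z - 1).toNat < c (z + 1) - c z ∧ 0 < c (z + 1) - c z := by
    intro z
    rw [hc, add_sub_cancel_left]
    have h1 := abs_nonneg (v z - l z)
    have h2 := abs_nonneg (g z.toNat)
    have h3 := abs_nonneg (g (-z - 1).toNat)
    refine ⟨?_, ?_, ?_, by positivity⟩
    · refine lt_of_le_of_lt (le_abs_self _) (lt_of_le_of_lt ?_ (lt_add_of_pos_right _ he))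
      exact le_add_of_le_of_nonneg (le_add_of_nonneg_right h2) h3
    · refine lt_of_le_of_lt (le_abs_self _) (lt_of_le_of_lt ?_ (lt_add_of_pos_right _ he))
      exact le_add_of_le_of_nonneg (le_add_of_nonneg_left h1) h3
    · refine lt_of_le_of_lt (neg_le_abs _) (lt_of_le_of_lt ?_ (lt_add_of_pos_right _ he))
      exact le_add_of_nonneg_left (add_nonneg h1 h2)
  have hcm : StrictMono c := strictMono_int_of_lt_succ fun z => sub_pos.1 (hstep z).2.2.2
  have hc1 : ∀ x, ∃ z, x < c z := by
    intro x
    obtain ⟨n, rfl⟩ := hg x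
    refine ⟨n + 1, lt_of_lt_of_le (hstep n).2.1 (sub_le_self _ ?_)⟩
    rw [← hc0]
    exact hcm.monotone (by omega)
  have hc2 : ∀ x, ∃ z, c z ≤ x := by
    intro x
    obtain ⟨n, rfl⟩ := hg x
    have h1 := (hstep (-(n : ℤ) - 1)).2.2.1
    have h2 : c (-(n : ℤ) - 1 + 1) ≤ 0 := by
      rw [← hc0]
      exact hcm.monotone (by omega)
    have h3 : (-(-(n : ℤ) - 1) - 1).toNat = n := by omega
    rw [h3] at h1
    refine ⟨-(n : ℤ) - 1, le_of_lt (neg_lt_neg_iff.1 (h1.trans_le ?_))⟩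
    rw [sub_eq_add_neg]
    exact add_le_of_nonpos_left h2
  choose idx hidx using exists_int_block hcm.monotone hc1 hc2
  have idx_mono : Monotone idx := fun i i' hi =>
    block_le_of_le hcm.monotone hi (hidx i).1 (hidx i').2
  have idx_eq : ∀ x n, c n ≤ x → x < c (n + 1) → idx x = n := fun i n h1 h2 =>
    le_antisymm (block_le_of_le hcm.monotone le_rfl (hidx i).1 h2)
      (block_le_of_le hcm.monotone le_rfl h1 (hidx i).2)
  refine ⟨fun x => h (idx x) (x - c (idx x) + l (idx x)), fun x y hxy => ?_, fun y => ?_⟩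
  · dsimp only
    rcases (idx_mono hxy).lt_or_eq with hlt | heq
    · exact (hS _ _).2.trans ((hb (by omega)).trans (hS _ _).1)
    · rw [← heq]
      exact hm _ (by gcongr)
  · obtain ⟨n1, hn1⟩ := hb1 y
    obtain ⟨n0, hn0⟩ := hb2 y
    -- The cap `n1` is needed because `b` may be eventually constant, namely when `N` has a greatest
    -- element.
    obtain ⟨n, ⟨hn, hny⟩, hmax⟩ := Int.exists_greatest_of_bdd (P := fun z => z ≤ n1 ∧ b z ≤ y)
      ⟨n1, fun z hz => hz.1⟩ ⟨min n0 n1, min_le_right _ _, (hb (min_le_left _ _)).trans hn0⟩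
    have hval : ∀ x, c n ≤ x → x < c (n + 1) →
        h (idx x) (x - c (idx x) + l (idx x)) = h n (x - c n + l n) := fun x h1 h2 => by
      rw [idx_eq x n h1 h2]
    rcases hn.lt_or_eq with hlt | rfl
    · have hy : y < b (n + 1) := not_le.1 fun h => absurd (hmax (n + 1) ⟨by omega, h⟩) (by omega)
      obtain ⟨x, hx⟩ := hs n y hny hy.le
      -- The preimage is moved into `[l n, v n)`; its value does not change, because `h n` takes its
      -- least value at `l n`.
      have hx' : h n (max x (l n)) = y := by
        rw [(hm n).map_max, hx, hl]
        exact max_eq_left hny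
      have hlt' : max x (l n) < v n := (hm n).reflect_lt (by rw [hx', hv]; exact hy)
      refine ⟨max x (l n) - l n + c n, ?_⟩
      beta_reduce
      rw [hval]
      · rw [add_sub_cancel_right, sub_add_cancel, hx']
      · exact le_add_of_nonneg_left (sub_nonneg.2 (le_max_right _ _))
      · rw [← lt_sub_iff_add_lt]
        exact (sub_lt_sub_right hlt' _).trans (hstep n).1
    -- At the cap, `y` equals `b n`, the value at the left end of block `n`.
    · refine ⟨c n, ?_⟩
      beta_reduce
      rw [hval _ le_rfl (hcm (by omega)), sub_self, zero_add, hl]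
      exact le_antisymm hny hn1

/-! ### Powers of well-orders -/

namespace IntPow

/-- After a translation taking the least element to `0`, the suborder vanishes above some `k` and is
non-negative at `k`. Hence it embeds in `ℤ^{<k} ω`, a well-ordered sum of copies of a strongly
surjective order. -/
theorem exists_monotone_surjective_of_bounded {K : Type} [LinearOrder K]
    (hK : ∀ k : K, StronglySurjective (IntPow {j // j < k})) (N : Type) [LinearOrder N]
    [BoundedOrder N] (j : N ↪o IntPow K) :
    ∃ g : IntPow K → N, Monotone g ∧ Function.Surjective g := by
  rcases subsingleton_or_nontrivial N with hN | hN
  · exact ⟨fun _ => ⊥, monotone_const, fun z => ⟨0, Subsingleton.elim _ _⟩⟩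
  have hlt : j ⊥ < j ⊤ := j.strictMono bot_lt_top
  have hpos : 0 < j ⊤ - j ⊥ := sub_pos.2 hlt
  obtain ⟨k, w, -, hw⟩ := exists_split_of_lt hpos
  have hw0 : (0 : IntPow {j // k < j}) = w := (hw 0 le_rfl hpos.le).1
  subst hw0
  have hN : ∀ y, restrict (k < ·) (j y - j ⊥) = 0 ∧ 0 ≤ ofColex (j y - j ⊥) k := fun y =>
    let h := hw (j y - j ⊥) (sub_nonneg.2 (j.monotone bot_le)) (sub_le_sub_right (j.monotone le_top) _)
    ⟨h.1, h.2.1⟩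
  let j' : N ↪o ℕ ×ₗ IntPow {j // j < k} := OrderEmbedding.ofStrictMono
    (fun y => toLex ((ofColex (j y - j ⊥) k).toNat, restrict (· < k) (j y - j ⊥))) (by
      intro y y' hy
      have h := (split k).strictMono (sub_lt_sub_right (j.strictMono hy) (j ⊥))
      rw [split_apply, split_apply, (hN y).1, (hN y').1, Prod.Lex.toLex_lt_toLex] at h
      have h' := (h.resolve_left (lt_irrefl _)).2
      dsimp only at h'
      rw [Prod.Lex.toLex_lt_toLex] at h' ⊢
      have h1 := (hN y).2
      have h2 := (hN y').2
      rcases h' with h' | ⟨h', h''⟩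
      · left
        dsimp only at h' ⊢
        omega
      · right
        dsimp only at h' h'' ⊢
        exact ⟨by omega, h''⟩)
  obtain ⟨h, hm, hs⟩ := exists_monotone_of_embedding_wellOrder_prod (hK k) N j' ⊤ fun _ => le_top
  -- The map `h` lives on a convex part of `ℤ^K`; everything below that part goes to `⊥` and
  -- everything above it to `⊤`.
  let F : IntPow {j // k < j} ×ₗ (ℤ ×ₗ IntPow {j // j < k}) → N := fun x =>
    if (ofLex x).1 < 0 then ⊥ else if 0 < (ofLex x).1 then ⊤ else
      if (ofLex (ofLex x).2).1 < 0 then ⊥ else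
        h (toLex ((ofLex (ofLex x).2).1.toNat, (ofLex (ofLex x).2).2))
  have hF : Monotone F := by
    rintro ⟨u, z, a⟩ ⟨u', z', a'⟩ hle
    have hle' : toLex (u, toLex (z, a)) ≤ toLex (u', toLex (z', a')) := hle
    change (if u < 0 then ⊥ else if 0 < u then ⊤ else
        if z < 0 then ⊥ else h (toLex (z.toNat, a))) ≤
      (if u' < 0 then ⊥ else if 0 < u' then ⊤ else
        if z' < 0 then ⊥ else h (toLex (z'.toNat, a')))
    rw [Prod.Lex.toLex_le_toLex', Prod.Lex.toLex_le_toLex] at hle'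
    obtain ⟨hu, hle'⟩ := hle'
    dsimp only at hu hle'
    by_cases h1 : u < 0
    · rw [if_pos h1]; exact bot_le
    by_cases h2 : 0 < u'
    · rw [if_neg h2.not_gt, if_pos h2]; exact le_top
    have hu0 : u = 0 := le_antisymm (hu.trans (not_lt.1 h2)) (not_lt.1 h1)
    have hu0' : u' = 0 := le_antisymm (not_lt.1 h2) ((not_lt.1 h1).trans hu)
    subst hu0 hu0'
    simp only [lt_irrefl, if_false]
    have hz := hle' rfl
    by_cases h3 : z < 0
    · rw [if_pos h3]; exact bot_le
    have h4 : ¬ z' < 0 := by rcases hz with h | h <;> omega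
    rw [if_neg h3, if_neg h4]
    apply hm
    rw [Prod.Lex.toLex_le_toLex]
    rcases hz with hz | hz
    · left; dsimp only; omega
    · right; exact ⟨by dsimp only; omega, hz.2⟩
  refine ⟨F ∘ split k, hF.comp (split k).monotone, fun y => ?_⟩
  obtain ⟨⟨n, a⟩, hx, -⟩ := hs y
  refine ⟨(split k).symm (toLex (0, toLex ((n : ℤ), a))), ?_⟩
  rw [Function.comp_apply, OrderIso.apply_symm_apply]
  change (if (0 : IntPow {j // k < j}) < 0 then ⊥ else if (0 : IntPow {j // k < j}) < 0 then ⊤ else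
        if (n : ℤ) < 0 then ⊥ else h (toLex ((n : ℤ).toNat, a))) = y
  rw [if_neg (lt_irrefl _), if_neg (lt_irrefl _), if_neg (by omega), Int.toNat_natCast]
  exact hx

/-- Induction on well-orders along proper initial segments. -/
theorem _root_.wellOrder_induction {P : ∀ (K : Type) [LinearOrder K], Prop}
    (ind : ∀ (K : Type) [LinearOrder K] [WellFoundedLT K], (∀ k : K, P {j // j < k}) → P K)
    (K : Type) [LinearOrder K] [WellFoundedLT K] : P K := by
  suffices H : ∀ (o : Ordinal.{0}) (K : Type) [LinearOrder K] [WellFoundedLT K],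
      Ordinal.type ((· < ·) : K → K → Prop) = o → P K from H _ K rfl
  intro o
  induction o using WellFoundedLT.induction with
  | ind o ih =>
    rintro K _ _ rfl
    exact ind K fun k => ih (Ordinal.type ((· < ·) : {j // j < k} → {j // j < k} → Prop))
      (Ordinal.typein_lt_type (· < ·) k) _ rfl

theorem stronglySurjective (K : Type) [LinearOrder K] [WellFoundedLT K] [Countable K] :
    StronglySurjective (IntPow K) := by
  refine wellOrder_induction (P := fun K _ => Countable K → StronglySurjective (IntPow K))
    (fun K _ _ ih hK => ?_) K ‹_›
  exact StronglySurjective.of_bounded fun N _ _ ⟨j⟩ =>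
    exists_monotone_surjective_of_bounded (fun k => ih k inferInstance) N j

/-- For a well-order `K`, the power `ℤ^K` does not embed in a bounded part of itself. -/
theorem not_strictMono_bounded (K : Type) [LinearOrder K] [WellFoundedLT K]
    (e : IntPow K → IntPow K) (he : StrictMono e) (a b : IntPow K) (ha : ∀ x, a < e x)
    (hb : ∀ x, e x < b) : False := by
  refine wellOrder_induction (P := fun K _ => ∀ (e : IntPow K → IntPow K), StrictMono e →
    ∀ a b : IntPow K, (∀ x, a < e x) → (∀ x, e x < b) → False)
    (fun K _ _ ih e he a b ha hb => ?_) K e he a b ha hb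
  obtain ⟨k, w, -, hw⟩ := exists_split_of_lt ((ha 0).trans (hb 0))
  -- An `ω`-sequence of consecutive copies of `ℤ^{<k}` inside `ℤ^K`.
  let u : ℕ → IntPow {j // j < k} → IntPow K := fun n y =>
    (split k).symm (toLex (0, toLex ((n : ℤ), y)))
  have hu : ∀ {n m y z}, n < m ∨ n = m ∧ y < z → u n y < u m z := by
    intro n m y z h
    refine (split k).symm.strictMono ?_
    simp only [Prod.Lex.toLex_lt_toLex]
    rcases h with h | h
    · exact Or.inr ⟨trivial, Or.inl (by omega)⟩
    · exact Or.inr ⟨trivial, Or.inr ⟨by omega, h.2⟩⟩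
  have hwe : ∀ x, restrict (k < ·) (e x) = w ∧ ofColex (e x) k ≤ ofColex b k := fun x =>
    ⟨(hw _ (ha x).le (hb x).le).1, (hw _ (ha x).le (hb x).le).2.2⟩
  have hval : ∀ {x y}, x < y → toLex (ofColex (e x) k, restrict (· < k) (e x)) <
      toLex (ofColex (e y) k, restrict (· < k) (e y)) := by
    intro x y hxy
    have h := (split k).strictMono (he hxy)
    rw [split_apply, split_apply, (hwe x).1, (hwe y).1, Prod.Lex.toLex_lt_toLex] at h
    exact (h.resolve_left (lt_irrefl _)).2
  have hval1 : ∀ {x y}, x < y → ofColex (e x) k ≤ ofColex (e y) k := fun h =>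
    (Prod.Lex.toLex_lt_toLex'.1 (hval h)).1
  -- Along the copies, the coordinate of `e` at `k` is increasing and bounded, so it is constant
  -- from some copy `n` on. There `e` is strictly increasing in the coordinates below `k`, and copy
  -- `n + 1` lands strictly between two values: a counterexample for `ℤ^{<k}`.
  obtain ⟨z, ⟨n, hn⟩, hmax⟩ := Int.exists_greatest_of_bdd
    (P := fun z => ∃ n : ℕ, ofColex (e (u n 0)) k = z)
    ⟨ofColex b k, by rintro z ⟨n, rfl⟩; exact (hwe _).2⟩ ⟨_, 0, rfl⟩
  have hconst : ∀ x, u n 0 ≤ x → x ≤ u (n + 2) 0 → ofColex (e x) k = z := by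
    intro x h1 h2
    have h3 := hmax _ ⟨n + 2, rfl⟩
    have h4 : ofColex (e x) k ≤ ofColex (e (u (n + 2) 0)) k := by
      rcases h2.lt_or_eq with h | rfl
      exacts [hval1 h, le_rfl]
    have h5 : ofColex (e (u n 0)) k ≤ ofColex (e x) k := by
      rcases h1.lt_or_eq with h | rfl
      exacts [hval1 h, le_rfl]
    omega
  have hlt : ∀ x y, u n 0 ≤ x → x < y → y ≤ u (n + 2) 0 →
      restrict (· < k) (e x) < restrict (· < k) (e y) := by
    intro x y h1 h2 h3
    have h := hval h2
    rw [hconst x h1 (h2.le.trans h3), hconst y (h1.trans h2.le) h3, Prod.Lex.toLex_lt_toLex] at h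
    exact (h.resolve_left (lt_irrefl _)).2
  have hl : ∀ y, u n 0 < u (n + 1) y := fun y => hu (Or.inl (by omega))
  have hr : ∀ y, u (n + 1) y < u (n + 2) 0 := fun y => hu (Or.inl (by omega))
  exact ih k (fun y => restrict (· < k) (e (u (n + 1) y)))
    (fun y z hyz => hlt _ _ (hl y).le (hu (Or.inr ⟨rfl, hyz⟩)) (hr z).le)
    (restrict (· < k) (e (u n 0))) (restrict (· < k) (e (u (n + 2) 0)))
    (fun y => hlt _ _ le_rfl (hl y) (hr y).le) (fun y => hlt _ _ (hl y).le (hr y) le_rfl)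

end IntPow

/-! ### Dense images -/

/-- Every countable linear order is an image of a countable dense order without endpoints. -/
theorem exists_monotone_surjective_of_dense (R N : Type) [LinearOrder R] [DenselyOrdered R]
    [NoMinOrder R] [NoMaxOrder R] [Nonempty R] [Countable R] [LinearOrder N] [Nonempty N]
    [Countable N] : ∃ g : R → N, Monotone g ∧ Function.Surjective g := by
  have : Countable (N ×ₗ ℚ) := inferInstanceAs (Countable (N × ℚ))
  have : Nonempty (N ×ₗ ℚ) := inferInstanceAs (Nonempty (N × ℚ))
  obtain ⟨e⟩ := Order.iso_of_countable_dense R (N ×ₗ ℚ)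
  refine ⟨fun x => (ofLex (e x)).1, fun x y hxy => Prod.Lex.monotone_fst _ _ (e.monotone hxy),
    fun y => ⟨e.symm (toLex (y, 0)), ?_⟩⟩
  simp

/-- An order with a countable dense image without endpoints is strongly surjective. -/
theorem StronglySurjective.of_dense_image {M R : Type} [LinearOrder M] [Countable M]
    [LinearOrder R] [DenselyOrdered R] [NoMinOrder R] [NoMaxOrder R] [Nonempty R] (f : M → R)
    (hf : Monotone f) (hs : Function.Surjective f) : StronglySurjective M := by
  intro N _ _ ⟨j⟩
  have : Countable N := j.injective.countable
  have : Countable R := hs.countable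
  obtain ⟨g, hg, hgs⟩ := exists_monotone_surjective_of_dense R N
  exact ⟨g ∘ f, hg.comp hf, hgs.comp hs⟩

namespace IntPow

variable {K : Type} [LinearOrder K]

instance noMaxOrder [Nonempty K] : NoMaxOrder (IntPow K) where
  exists_gt x := by
    obtain ⟨k⟩ := ‹Nonempty K›
    refine ⟨(split k).symm (toLex ((ofLex (split k x)).1,
      toLex ((ofLex (ofLex (split k x)).2).1 + 1, 0))), ?_⟩
    rw [OrderIso.lt_symm_apply, split_apply, Prod.Lex.lt_iff]
    refine Or.inr ⟨rfl, Prod.Lex.toLex_lt_toLex.2 (Or.inl ?_)⟩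
    exact lt_add_one (ofColex x k)

instance noMinOrder [Nonempty K] : NoMinOrder (IntPow K) where
  exists_lt x := by
    obtain ⟨y, hy⟩ := exists_gt (-x)
    exact ⟨-y, neg_lt.1 hy⟩

/-- If `x` and `y` first differ at `k` from above, `x` can be increased below `k`, where there is
room as `k` is not minimal; the result stays below `y`. -/
instance denselyOrdered [NoMinOrder K] : DenselyOrdered (IntPow K) where
  dense x y hxy := by
    obtain ⟨k, hk, hlt⟩ := lt_iff.1 hxy
    obtain ⟨i, hi⟩ := exists_lt k
    have : Nonempty {j // j < k} := ⟨⟨i, hi⟩⟩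
    obtain ⟨b, hb⟩ := exists_gt (restrict (· < k) x)
    refine ⟨(split k).symm (toLex (restrict (k < ·) x, toLex (ofColex x k, b))), ?_, ?_⟩
    · rw [OrderIso.lt_symm_apply, split_apply]
      exact Prod.Lex.toLex_lt_toLex.2 (Or.inr ⟨rfl, Prod.Lex.toLex_lt_toLex.2 (Or.inr ⟨rfl, hb⟩)⟩)
    · rw [OrderIso.symm_apply_lt, split_apply]
      exact Prod.Lex.toLex_lt_toLex.2 (Or.inr ⟨ofColex.injective (Finsupp.ext fun j => hk j j.2),
        Prod.Lex.toLex_lt_toLex.2 (Or.inl hlt)⟩)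

end IntPow

/-! ### When `ℤ^K (1 + L) ω` is strongly surjective -/

section Reduction

variable (K L : Type) [LinearOrder K] [LinearOrder L]

instance [Countable K] [Countable L] : Countable (ℕ ×ₗ ((Unit ⊕ₗ L) ×ₗ IntPow K)) :=
  inferInstanceAs (Countable (ℕ × ((Unit ⊕ L) × IntPow K)))

theorem stronglySurjective_of_not_wellFounded [Countable K] [Countable L]
    (hK : ¬ WellFoundedLT K) : StronglySurjective (ℕ ×ₗ ((Unit ⊕ₗ L) ×ₗ IntPow K)) := by
  -- The non-accessible points are closed upwards. A least one would have only accessible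
  -- predecessors and so be accessible.
  let p : K → Prop := fun k => ¬ Acc (· < ·) k
  have hp : ∀ i j, i ≤ j → p i → p j := by
    intro i j hij hi hj
    rcases hij.lt_or_eq with h | rfl
    · exact hi (hj.inv h)
    · exact hi hj
  have hne : Nonempty {k // p k} := by
    by_contra h
    exact hK ⟨⟨fun k => by_contra fun hk => h ⟨⟨k, hk⟩⟩⟩⟩
  have hmin : NoMinOrder {k // p k} := ⟨fun k => by
    by_contra! h
    exact k.2 ⟨_, fun i hi => by_contra fun hpi => absurd hi (not_lt.2 (h ⟨i, hpi⟩))⟩⟩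
  have : Nonempty (ℕ ×ₗ ((Unit ⊕ₗ L) ×ₗ IntPow {k // p k})) :=
    ⟨toLex (0, toLex (toLex (Sum.inl ()), 0))⟩
  refine StronglySurjective.of_dense_image (R := ℕ ×ₗ ((Unit ⊕ₗ L) ×ₗ IntPow {k // p k}))
    (fun x => toLex ((ofLex x).1, toLex ((ofLex (ofLex x).2).1,
      IntPow.restrict p (ofLex (ofLex x).2).2))) ?_ ?_
  · rintro ⟨n, l, a⟩ ⟨n', l', a'⟩ hle
    have hle' : toLex (n, toLex (l, a)) ≤ toLex (n', toLex (l', a')) := hle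
    change toLex (n, toLex (l, IntPow.restrict p a)) ≤ toLex (n', toLex (l', IntPow.restrict p a'))
    simp only [Prod.Lex.toLex_le_toLex] at hle' ⊢
    exact hle'.imp_right (And.imp_right (Or.imp_right (And.imp_right
      fun h => IntPow.restrict_monotone hp h)))
  · rintro ⟨n, l, a⟩
    obtain ⟨b, rfl⟩ := IntPow.restrict_surjective p a
    exact ⟨toLex (n, toLex (l, b)), rfl⟩

theorem stronglySurjective_of_wellFounded [Countable K] [Countable L] [WellFoundedLT K]
    [WellFoundedLT L] : StronglySurjective (ℕ ×ₗ ((Unit ⊕ₗ L) ×ₗ IntPow K)) := by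
  have : WellFoundedLT (Unit ⊕ₗ L) := ⟨Sum.lex_wf wellFounded_lt wellFounded_lt⟩
  have : Countable (Unit ⊕ₗ L) := inferInstanceAs (Countable (Unit ⊕ L))
  exact ((IntPow.stronglySurjective K).nat_prod (C := Unit ⊕ₗ L)).of_orderIso
    (Prod.Lex.prodLexAssoc _ _ _)

/-- A descending sequence in `L` embeds `ℤ^K ω*` in the order. A surjection onto it sends a point of
the first copy of `ℤ^K` into some block, and all lower blocks must then be covered from below that
point, hence by the first copy alone. -/
theorem not_stronglySurjective [WellFoundedLT K] (hL : ¬ WellFoundedLT L) :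
    ¬ StronglySurjective (ℕ ×ₗ ((Unit ⊕ₗ L) ×ₗ IntPow K)) := by
  intro h
  have hL' : ¬ WellFounded ((· < ·) : L → L → Prop) := fun h => hL ⟨h⟩
  obtain ⟨f, hf⟩ : ∃ f : ℕ → L, ∀ n, f (n + 1) < f n := by
    by_contra hne
    exact hL' (wellFounded_iff_isEmpty_descending_chain.2 ⟨fun f => hne ⟨f.1, f.2⟩⟩)
  have hf : StrictAnti f := strictAnti_nat_of_succ_lt hf
  have : Nonempty (ℕᵒᵈ ×ₗ IntPow K) := ⟨toLex (OrderDual.toDual 0, 0)⟩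
  obtain ⟨g, hg, hs⟩ := h (ℕᵒᵈ ×ₗ IntPow K) ⟨OrderEmbedding.ofStrictMono
    (fun x => toLex (0, toLex (toLex (Sum.inr (f (OrderDual.ofDual (ofLex x).1))), (ofLex x).2))) (by
      rintro ⟨n, a⟩ ⟨n', a'⟩ hlt
      have hlt' : toLex (n, a) < toLex (n', a') := hlt
      refine Prod.Lex.toLex_lt_toLex.2 (Or.inr ⟨rfl, Prod.Lex.toLex_lt_toLex.2 ?_⟩)
      rcases Prod.Lex.toLex_lt_toLex.1 hlt' with h | ⟨h1, h2⟩
      · exact Or.inl (Sum.Lex.inr_lt_inr_iff.2 (hf h))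
      · change n = n' at h1
        subst h1
        exact Or.inr ⟨rfl, h2⟩)⟩
  let i : IntPow K → ℕ ×ₗ ((Unit ⊕ₗ L) ×ₗ IntPow K) := fun a =>
    toLex (0, toLex (toLex (Sum.inl ()), a))
  have hi : ∀ a b, i a < i b → a < b := by
    intro a b hab
    simpa [i, Prod.Lex.toLex_lt_toLex] using hab
  obtain ⟨n, hn⟩ : ∃ n, OrderDual.ofDual (ofLex (g (i 0))).1 = n := ⟨_, rfl⟩
  have hfirst : ∀ x, x < i 0 → ∃ a, i a = x := by
    rintro ⟨m, c, a⟩ hlt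
    have hlt' : toLex (m, toLex (c, a)) < i 0 := hlt
    simp only [i, Prod.Lex.toLex_lt_toLex] at hlt'
    rcases hlt' with h | ⟨rfl, h | ⟨rfl, -⟩⟩
    · exact absurd h (Nat.not_lt_zero _)
    · obtain ⟨c⟩ := c
      rcases c with c | c
      · exact absurd (Sum.Lex.inl_lt_inl_iff.1 h) (lt_irrefl _)
      · exact absurd h Sum.Lex.not_inr_lt_inl
    · exact ⟨a, rfl⟩
  -- In `ℕᵒᵈ` the blocks `m > n` lie below block `n`. The value `0` for `m ≤ n` is a dummy.
  have key : ∀ (m : ℕ) (a : IntPow K), ∃ b, n < m → g (i b) = toLex (OrderDual.toDual m, a) := by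
    intro m a
    by_cases hm : n < m
    · obtain ⟨x, hx⟩ := hs (toLex (OrderDual.toDual m, a))
      obtain ⟨b, rfl⟩ := hfirst x (hg.reflect_lt (by
        rw [hx, Prod.Lex.lt_iff]
        exact Or.inl (by rw [← OrderDual.ofDual_lt_ofDual, hn]; exact hm)))
      exact ⟨b, fun _ => hx⟩
    · exact ⟨0, fun h => absurd h hm⟩
  choose s hs using key
  have hlt : ∀ m m' a a', n < m → n < m' →
      (toLex (OrderDual.toDual m, a) : ℕᵒᵈ ×ₗ IntPow K) < toLex (OrderDual.toDual m', a') →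
      s m a < s m' a' := fun m m' a a' hm hm' h =>
    hi _ _ (hg.reflect_lt (by rw [hs m a hm, hs m' a' hm']; exact h))
  -- Preimages of block `n + 2` embed `ℤ^K` between preimages of points of the blocks `n + 3` and `n
  -- + 1`.
  refine IntPow.not_strictMono_bounded K (s (n + 2))
    (fun a b hab => hlt _ _ _ _ (by omega) (by omega)
      (Prod.Lex.toLex_lt_toLex.2 (Or.inr ⟨rfl, hab⟩))) (s (n + 3) 0) (s (n + 1) 0) ?_ ?_
  · exact fun a => hlt _ _ _ _ (by omega) (by omega)
      (Prod.Lex.toLex_lt_toLex.2 (Or.inl (OrderDual.toDual_lt_toDual.2 (by omega))))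
  · exact fun a => hlt _ _ _ _ (by omega) (by omega)
      (Prod.Lex.toLex_lt_toLex.2 (Or.inl (OrderDual.toDual_lt_toDual.2 (by omega))))

theorem stronglySurjective_iff [Countable K] [Countable L] :
    StronglySurjective (ℕ ×ₗ ((Unit ⊕ₗ L) ×ₗ IntPow K)) ↔ ¬ WellFoundedLT K ∨ WellFoundedLT L := by
  by_cases hK : WellFoundedLT K
  · by_cases hL : WellFoundedLT L
    · exact iff_of_true (stronglySurjective_of_wellFounded K L) (Or.inr hL)
    · exact iff_of_false (not_stronglySurjective K L hL) (by tauto)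
  · exact iff_of_true (stronglySurjective_of_not_wellFounded K L hK) (Or.inl hK)

end Reduction

/-! ### Clopen conditions -/

section Clopen

variable {X : Type*} [TopologicalSpace X]

theorem IsClopen.setOf_const (p : Prop) : IsClopen {_x : X | p} := by
  by_cases h : p <;> simp [h, isClopen_univ, isClopen_empty]

theorem IsClopen.setOf_and {p q : X → Prop} (hp : IsClopen {x | p x}) (hq : IsClopen {x | q x}) :
    IsClopen {x | p x ∧ q x} := hp.inter hq

theorem IsClopen.setOf_or {p q : X → Prop} (hp : IsClopen {x | p x}) (hq : IsClopen {x | q x}) :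
    IsClopen {x | p x ∨ q x} := hp.union hq

theorem IsClopen.setOf_imp {p q : X → Prop} (hp : IsClopen {x | p x}) (hq : IsClopen {x | q x}) :
    IsClopen {x | p x → q x} := by
  simp only [imp_iff_not_or]
  exact IsClopen.setOf_or hp.compl hq

theorem IsClopen.setOf_forall_mem {ι : Type*} (s : Finset ι) {p : ι → X → Prop}
    (hp : ∀ i ∈ s, IsClopen {x | p i x}) : IsClopen {x | ∀ i ∈ s, p i x} := by
  simpa only [Set.ofPred_forall] using isClopen_biInter_finset hp

theorem IsClopen.setOf_exists_mem {ι : Type*} (s : Finset ι) {p : ι → X → Prop}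
    (hp : ∀ i ∈ s, IsClopen {x | p i x}) : IsClopen {x | ∃ i ∈ s, p i x} := by
  convert isClopen_biUnion_finset hp using 1
  ext x
  simp

end Clopen

/-! ### Order types of the codes and continuity of the operations -/

namespace Lin

section OfInjective

variable {α : Type} [LinearOrder α] [Nonempty α] (e : α → ℕ) (he : Function.Injective e)

theorem ofInjective_apply (m n : ℕ) :
    (ofInjective e he).1 (m, n) = true ↔ ∃ a b : α, e a = m ∧ e b = n ∧ a ≤ b := by
  classical
  exact decide_eq_true_iff

theorem ofInjective_apply_code (a b : α) : (ofInjective e he).1 (e a, e b) = true ↔ a ≤ b := by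
  rw [ofInjective_apply]
  constructor
  · rintro ⟨a', b', ha, hb, h⟩
    rwa [he ha, he hb] at h
  · exact fun h => ⟨a, b, rfl, rfl, h⟩

/-- The coded order is isomorphic to the given one. -/
noncomputable def ofInjectiveIso : (ofInjective e he).Carrier ≃o α :=
  OrderIso.symm <| StrictMono.orderIsoOfSurjective
    (fun a => (⟨e a, (ofInjective_apply_code e he a a).2 le_rfl⟩ : (ofInjective e he).Carrier))
    ((OrderEmbedding.ofMapLEIff (β := (ofInjective e he).Carrier) _
      fun a b => ofInjective_apply_code e he a b).strictMono)
    (by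
      rintro ⟨n, hn⟩
      obtain ⟨a, b, ha, -, -⟩ := (ofInjective_apply e he n n).1 hn
      exact ⟨a, Subtype.ext ha⟩)

end OfInjective

instance (K : Lin) : Countable K.Carrier := inferInstanceAs (Countable {n : ℕ // K.1 (n, n) = true})

noncomputable def addIso (K L : Lin) : (K.add L).Carrier ≃o K.Carrier ⊕ₗ L.Carrier :=
  haveI : Nonempty (K.Carrier ⊕ₗ L.Carrier) :=
    (inferInstance : Nonempty K.Carrier).map fun k => toLex (Sum.inl k)
  ofInjectiveIso _ (addCode_injective K L)

noncomputable def mulIso (K L : Lin) : (K.mul L).Carrier ≃o L.Carrier ×ₗ K.Carrier :=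
  haveI : Nonempty (L.Carrier ×ₗ K.Carrier) :=
    (inferInstance : Nonempty (L.Carrier × K.Carrier)).map toLex
  ofInjectiveIso _ (mulCode_injective K L)

noncomputable def zetaPowIso (K : Lin) : K.zetaPow.Carrier ≃o IntPow K.Carrier :=
  haveI : Nonempty (IntPow K.Carrier) := ⟨toColex 0⟩
  ofInjectiveIso _ (zetaCode_injective K)

/-- The order type of `ζ^K (1 + L) ω`. -/
noncomputable def reductionIso (K L : Lin) :
    (reduction (K, L)).Carrier ≃o ℕ ×ₗ ((Unit ⊕ₗ L.Carrier) ×ₗ IntPow K.Carrier) :=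
  (mulIso _ _).trans <| Prod.Lex.prodLexCongr (ofInjectiveIso _ _) <|
    (mulIso _ _).trans <| Prod.Lex.prodLexCongr
      ((addIso _ _).trans (OrderIso.sumLexCongr (ofInjectiveIso _ _) (OrderIso.refl _)))
      (zetaPowIso K)

section Continuity

variable {X : Type*} [TopologicalSpace X]

theorem continuous_iff {f : X → Lin} :
    Continuous f ↔ ∀ m n, IsClopen {x | (f x).1 (m, n) = true} := by
  have h : Continuous f ↔ Continuous fun x => (f x).1 :=
    Topology.IsInducing.continuous_iff (Topology.IsInducing.subtypeVal (t := {r | IsLinCode r}))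
  rw [h, continuous_pi_iff]
  simp only [Prod.forall, continuous_bool_rng true]
  rfl

theorem add_apply (K L : Lin) (m n : ℕ) : (K.add L).1 (m, n) = true ↔
    (m % 2 = 0 ∧ n % 2 = 0 ∧ K.1 (m / 2, n / 2) = true) ∨
    (m % 2 = 0 ∧ n % 2 = 1 ∧ K.1 (m / 2, m / 2) = true ∧ L.1 (n / 2, n / 2) = true) ∨
    (m % 2 = 1 ∧ n % 2 = 1 ∧ L.1 (m / 2, n / 2) = true) := by
  have : Nonempty (K.Carrier ⊕ₗ L.Carrier) :=
    (inferInstance : Nonempty K.Carrier).map fun k => toLex (Sum.inl k)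
  refine (ofInjective_apply _ (addCode_injective K L) m n).trans ⟨?_, ?_⟩
  · rintro ⟨x, y, rfl, rfl, h⟩
    have h0 : ∀ k, (2 * k) % 2 = 0 ∧ (2 * k + 1) % 2 = 1 ∧ (2 * k) / 2 = k ∧
        (2 * k + 1) / 2 = k := fun k => by omega
    rcases x with x | x <;> rcases y with y | y
    · left
      change (2 * x.1) % 2 = 0 ∧ (2 * y.1) % 2 = 0 ∧ K.1 ((2 * x.1) / 2, (2 * y.1) / 2) = true
      rw [(h0 x.1).2.2.1, (h0 y.1).2.2.1]
      exact ⟨(h0 _).1, (h0 _).1, Sum.Lex.inl_le_inl_iff.1 h⟩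
    · right; left
      change (2 * x.1) % 2 = 0 ∧ (2 * y.1 + 1) % 2 = 1 ∧ K.1 ((2 * x.1) / 2, (2 * x.1) / 2) = true ∧
        L.1 ((2 * y.1 + 1) / 2, (2 * y.1 + 1) / 2) = true
      rw [(h0 x.1).2.2.1, (h0 y.1).2.2.2]
      exact ⟨(h0 _).1, (h0 _).2.1, x.2, y.2⟩
    · exact absurd h Sum.Lex.not_inr_le_inl
    · right; right
      change (2 * x.1 + 1) % 2 = 1 ∧ (2 * y.1 + 1) % 2 = 1 ∧
        L.1 ((2 * x.1 + 1) / 2, (2 * y.1 + 1) / 2) = true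
      rw [(h0 x.1).2.2.2, (h0 y.1).2.2.2]
      exact ⟨(h0 _).2.1, (h0 _).2.1, Sum.Lex.inr_le_inr_iff.1 h⟩
  · rintro (⟨hm, hn, h⟩ | ⟨hm, hn, h, h'⟩ | ⟨hm, hn, h⟩)
    · refine ⟨toLex (Sum.inl ⟨m / 2, K.2.mem_left _ _ h⟩),
        toLex (Sum.inl ⟨n / 2, K.2.mem_right _ _ h⟩), ?_, ?_, Sum.Lex.inl_le_inl_iff.2 h⟩
      · change 2 * (m / 2) = m; omega
      · change 2 * (n / 2) = n; omega
    · refine ⟨toLex (Sum.inl ⟨m / 2, h⟩), toLex (Sum.inr ⟨n / 2, h'⟩), ?_, ?_,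
        Sum.Lex.inl_le_inr _ _⟩
      · change 2 * (m / 2) = m; omega
      · change 2 * (n / 2) + 1 = n; omega
    · refine ⟨toLex (Sum.inr ⟨m / 2, L.2.mem_left _ _ h⟩),
        toLex (Sum.inr ⟨n / 2, L.2.mem_right _ _ h⟩), ?_, ?_, Sum.Lex.inr_le_inr_iff.2 h⟩
      · change 2 * (m / 2) + 1 = m; omega
      · change 2 * (n / 2) + 1 = n; omega

theorem mul_apply (K L : Lin) (a b c d : ℕ) :
    (K.mul L).1 (Nat.pair a b, Nat.pair c d) = true ↔
    K.1 (a, a) = true ∧ K.1 (c, c) = true ∧ L.1 (b, d) = true ∧ (b = d → K.1 (a, c) = true) := by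
  have : Nonempty (L.Carrier ×ₗ K.Carrier) :=
    (inferInstance : Nonempty (L.Carrier × K.Carrier)).map toLex
  refine (ofInjective_apply _ (mulCode_injective K L) _ _).trans ⟨?_, ?_⟩
  · rintro ⟨⟨y, x⟩, ⟨y', x'⟩, h1, h2, h⟩
    obtain ⟨rfl, rfl⟩ := Nat.pair_eq_pair.1 h1
    obtain ⟨rfl, rfl⟩ := Nat.pair_eq_pair.1 h2
    obtain ⟨h3, h4⟩ := Prod.Lex.toLex_le_toLex'.1 h
    exact ⟨x.2, x'.2, h3, fun h5 => h4 (Subtype.ext h5)⟩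
  · rintro ⟨ha, hc, h, h'⟩
    refine ⟨toLex (⟨b, L.2.mem_left _ _ h⟩, ⟨a, ha⟩), toLex (⟨d, L.2.mem_right _ _ h⟩, ⟨c, hc⟩),
      rfl, rfl, Prod.Lex.toLex_le_toLex'.2 ⟨h, fun h5 => h' (congrArg Subtype.val h5)⟩⟩

/-- The code of a map does not depend on `K`, and comparing two maps consults `K` only on the finite
union of their supports. This is what makes the power continuous. -/
theorem zetaPow_apply (K : Lin) (φ ψ : ℕ →₀ ℤ) :
    K.zetaPow.1 (Encodable.encode φ, Encodable.encode ψ) = true ↔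
    (∀ i ∈ φ.support ∪ ψ.support, K.1 (i, i) = true) ∧
    (φ = ψ ∨ ∃ i ∈ φ.support ∪ ψ.support, (∀ j ∈ φ.support ∪ ψ.support,
      K.1 (i, j) = true → i = j ∨ φ j = ψ j) ∧ φ i < ψ i) := by
  have : Nonempty (IntPow K.Carrier) := ⟨toColex 0⟩
  let E : (K.Carrier →₀ ℤ) → ℕ →₀ ℤ :=
    Finsupp.embDomain (⟨Subtype.val, Subtype.val_injective⟩ : K.Carrier ↪ ℕ)
  have hE : ∀ a (k : K.Carrier), E a k.1 = a k := fun a k => Finsupp.embDomain_apply_self _ _ _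
  have hE0 : ∀ a i, i ∈ (E a).support → K.1 (i, i) = true := by
    intro a i hi
    rw [Finsupp.support_embDomain, Finset.mem_map] at hi
    obtain ⟨k, -, rfl⟩ := hi
    exact k.2
  have hlt : ∀ a b, toColex a < toColex b ↔ ∃ i ∈ (E a).support ∪ (E b).support,
      (∀ j ∈ (E a).support ∪ (E b).support, K.1 (i, j) = true → i = j ∨ E a j = E b j) ∧
      E a i < E b i := by
    intro a b
    rw [IntPow.lt_iff]
    constructor
    · rintro ⟨i, hi, hlt⟩
      refine ⟨i.1, ?_, fun j hj hij => ?_, by rwa [hE, hE]⟩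
      · simp only [Finset.mem_union, Finsupp.mem_support_iff, hE]
        by_contra! h
        exact absurd hlt (by simp [h.1, h.2])
      · let j' : K.Carrier := ⟨j, K.2.mem_right _ _ hij⟩
        rcases (show i ≤ j' from hij).eq_or_lt with h | h
        · exact Or.inl (congrArg Subtype.val h)
        · exact Or.inr ((hE a j').trans ((hi j' h).trans (hE b j').symm))
    · rintro ⟨i, hi, hj, hlt⟩
      have hi' : K.1 (i, i) = true := (Finset.mem_union.1 hi).elim (hE0 _ _) (hE0 _ _)
      refine ⟨⟨i, hi'⟩, fun j hij => ?_, ?_⟩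
      swap
      · change a ⟨i, hi'⟩ < b ⟨i, hi'⟩
        exact lt_of_eq_of_lt (hE a ⟨i, hi'⟩).symm (hlt.trans_eq (hE b ⟨i, hi'⟩))
      change a j = b j
      rw [← hE, ← hE]
      by_cases hjs : j.1 ∈ (E a).support ∪ (E b).support
      · exact (hj _ hjs hij.le).resolve_left fun h => hij.ne (Subtype.ext h)
      · simp only [Finset.mem_union, Finsupp.mem_support_iff, not_or, not_not] at hjs
        rw [hjs.1, hjs.2]
  refine (ofInjective_apply _ (zetaCode_injective K) _ _).trans ⟨?_, ?_⟩
  · rintro ⟨a, b, h1, h2, h⟩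
    obtain rfl : E (ofColex a) = φ := Encodable.encode_injective h1
    obtain rfl : E (ofColex b) = ψ := Encodable.encode_injective h2
    refine ⟨fun i hi => (Finset.mem_union.1 hi).elim (hE0 _ _) (hE0 _ _), ?_⟩
    rcases h.eq_or_lt with h | h
    · exact Or.inl (congrArg E (congrArg ofColex h))
    · exact Or.inr ((hlt (ofColex a) (ofColex b)).1 h)
  · rintro ⟨hdom, h⟩
    have hex : ∀ χ : ℕ →₀ ℤ, (∀ i ∈ χ.support, K.1 (i, i) = true) → ∃ a, E a = χ := by
      intro χ hχ
      exact ⟨χ.comapDomain _ (Subtype.val_injective.injOn), Finsupp.embDomain_comapDomain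
        (f := (⟨Subtype.val, Subtype.val_injective⟩ : K.Carrier ↪ ℕ))
        fun i hi => ⟨⟨i, hχ i hi⟩, rfl⟩⟩
    obtain ⟨a, rfl⟩ := hex φ fun i hi => hdom i (Finset.mem_union_left _ hi)
    obtain ⟨b, rfl⟩ := hex ψ fun i hi => hdom i (Finset.mem_union_right _ hi)
    refine ⟨toColex a, toColex b, rfl, rfl, ?_⟩
    rcases h with h | h
    · exact le_of_eq (congrArg toColex (Finsupp.embDomain_injective _ h))
    · exact ((hlt a b).2 h).le

variable {f g : X → Lin}

theorem continuous_add (hf : Continuous f) (hg : Continuous g) :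
    Continuous fun x => (f x).add (g x) := by
  rw [continuous_iff] at *
  intro m n
  simp only [add_apply]
  exact .setOf_or (.setOf_and (.setOf_const _) (.setOf_and (.setOf_const _) (hf _ _)))
    (.setOf_or (.setOf_and (.setOf_const _) (.setOf_and (.setOf_const _)
      (.setOf_and (hf _ _) (hg _ _))))
      (.setOf_and (.setOf_const _) (.setOf_and (.setOf_const _) (hg _ _))))

theorem continuous_mul (hf : Continuous f) (hg : Continuous g) :
    Continuous fun x => (f x).mul (g x) := by
  rw [continuous_iff] at *
  intro m n
  rw [← Nat.pair_unpair m, ← Nat.pair_unpair n]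
  simp only [mul_apply]
  exact .setOf_and (hf _ _) (.setOf_and (hf _ _) (.setOf_and (hg _ _)
    (.setOf_imp (.setOf_const _) (hf _ _))))

theorem continuous_zetaPow (hf : Continuous f) : Continuous fun x => (f x).zetaPow := by
  rw [continuous_iff] at *
  intro m n
  by_cases hmn : (∃ φ : ℕ →₀ ℤ, Encodable.encode φ = m) ∧ ∃ ψ : ℕ →₀ ℤ, Encodable.encode ψ = n
  · obtain ⟨⟨φ, rfl⟩, ψ, rfl⟩ := hmn
    simp only [zetaPow_apply]
    exact .setOf_and (.setOf_forall_mem _ fun i _ => hf _ _) (.setOf_or (.setOf_const _)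
      (.setOf_exists_mem _ fun i _ => .setOf_and (.setOf_forall_mem _ fun j _ =>
        .setOf_imp (hf _ _) (.setOf_const _)) (.setOf_const _)))
  -- A number that is not the code of a map lies in no domain.
  · convert isClopen_empty
    refine Set.eq_empty_of_forall_notMem fun x hx => hmn ?_
    have : Nonempty (IntPow (f x).Carrier) := ⟨toColex 0⟩
    obtain ⟨a, b, ha, hb, -⟩ := (ofInjective_apply _ (zetaCode_injective (f x)) m n).1 hx
    exact ⟨⟨_, ha⟩, _, hb⟩

end Continuity

theorem continuous_reduction : Continuous reduction :=
  continuous_mul (continuous_mul (continuous_zetaPow continuous_fst)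
    (continuous_add continuous_const continuous_snd)) continuous_const

theorem reduction_preimage_StS :
    reduction ⁻¹' StS = {p : Lin × Lin | p.1 ∉ WO ∨ p.2 ∈ WO} := by
  ext ⟨K, L⟩
  refine Iff.trans ⟨fun h => ?_, fun h => ?_⟩ (stronglySurjective_iff K.Carrier L.Carrier)
  · exact StronglySurjective.of_orderIso (reductionIso K L) h
  · exact StronglySurjective.of_orderIso (reductionIso K L).symm h

end Lin

/-! ### The Kleene–Brouwer order -/

/-- Finite sequences of natural numbers with the Kleene–Brouwer order: proper extensions come
first, and otherwise the first difference decides. -/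
structure KleeneBrouwer : Type where
  /-- The underlying sequence. -/
  toList : List ℕ

namespace KleeneBrouwer

/-- Appending an infinite entry turns the Kleene–Brouwer order into the lexicographic order. -/
def key (s : KleeneBrouwer) : List (WithTop ℕ) := List.map (↑) s.toList ++ [⊤]

theorem key_injective : Function.Injective key := by
  intro s t h
  have h' : s.toList = t.toList :=
    List.map_injective_iff.2 WithTop.coe_injective (List.append_cancel_right h)
  cases s
  cases t
  exact congrArg mk h'

noncomputable instance : LinearOrder KleeneBrouwer := LinearOrder.lift' key key_injective

theorem append_cons_lt (s t : List ℕ) (n : ℕ) :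
    mk (s ++ n :: t) < mk s := by
  change key (mk (s ++ n :: t)) < key (mk s)
  unfold key
  simp only [List.map_append, List.map_cons, List.append_assoc, List.cons_append]
  exact List.Lex.append_left _ (List.Lex.rel (WithTop.coe_lt_top n)) _

theorem append_cons_lt_append_cons (s t t' : List ℕ) {m n : ℕ} (h : m < n) :
    mk (s ++ m :: t) < mk (s ++ n :: t') := by
  change key (mk (s ++ m :: t)) < key (mk (s ++ n :: t'))
  unfold key
  simp only [List.map_append, List.map_cons, List.append_assoc, List.cons_append]
  exact List.Lex.append_left _ (List.Lex.rel (WithTop.coe_lt_coe.2 h)) _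

/-- A tree is well-ordered by the Kleene–Brouwer order if and only if it has no infinite branch. -/
theorem wellFoundedLT_iff (T : Set (List ℕ)) (h0 : [] ∈ T) (hT : ∀ s t, s ++ t ∈ T → s ∈ T) :
    WellFoundedLT {s : KleeneBrouwer // s.toList ∈ T} ↔ ¬ ∃ y : ℕ → ℕ, ∀ n, (List.range n).map y ∈ T := by
  constructor
  · rintro hwf ⟨y, hy⟩
    let a : ℕ → {s : KleeneBrouwer // s.toList ∈ T} := fun n => ⟨mk ((List.range n).map y), hy n⟩
    have ha : StrictAnti a := strictAnti_nat_of_succ_lt fun n => by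
      change mk ((List.range (n + 1)).map y) < mk ((List.range n).map y)
      rw [List.range_succ, List.map_append]
      exact append_cons_lt _ _ _
    exact wellFounded_iff_isEmpty_descending_chain.1 hwf.wf |>.false ⟨a, fun n => ha n.lt_succ_self⟩
  · intro hbr
    have hacc : Acc (fun t s : List ℕ => t ∈ T ∧ ∃ n, t = s ++ [n]) [] := by
      rw [acc_iff_isEmpty_descending_chain]
      refine ⟨fun ⟨f, hf0, hf⟩ => hbr ?_⟩
      choose hfT y hy using hf
      have hfy : ∀ n, f n = (List.range n).map y := by
        intro n
        induction n with
        | zero => exact hf0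
        | succ n ih => rw [hy, ih, List.range_succ, List.map_append, List.map_singleton]
      refine ⟨y, fun n => ?_⟩
      rw [← hfy]
      cases n with
      | zero => rw [hf0]; exact h0
      | succ n => exact hfT n
    -- By induction on the accessible node `s`: every non-empty set of extensions of `s` in the tree
    -- has a Kleene–Brouwer least element. The extensions through the least possible next entry
    -- precede all others and `s` itself, so the induction hypothesis at that child applies.
    have hmin : ∀ s, Acc (fun t s : List ℕ => t ∈ T ∧ ∃ n, t = s ++ [n]) s →
        ∀ S : Set (List ℕ), S ⊆ T → S.Nonempty → (∀ t ∈ S, ∃ r, t = s ++ r) →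
        ∃ m ∈ S, ∀ t ∈ S, mk m ≤ mk t := by
      intro s hs
      induction hs with
      | intro s _ ih =>
        intro S hST hne hext
        by_cases hprop : ∃ n r, s ++ n :: r ∈ S
        · classical
          obtain ⟨r, hr⟩ := Nat.find_spec hprop
          have hleast : ∀ m r, s ++ m :: r ∈ S → Nat.find hprop ≤ m := fun m r h =>
            Nat.find_min' hprop ⟨r, h⟩
          generalize Nat.find hprop = n at hr hleast
          have hcons : ∀ r : List ℕ, s ++ n :: r = (s ++ [n]) ++ r := fun r => by simp
          obtain ⟨m, ⟨hmS, q, hmq⟩, hm⟩ := ih (s ++ [n])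
            ⟨hT _ r (by rw [← hcons]; exact hST hr), n, rfl⟩
            {t | t ∈ S ∧ ∃ r, t = (s ++ [n]) ++ r} (fun t ht => hST ht.1)
            ⟨_, hr, r, hcons r⟩ (fun t ht => ht.2)
          refine ⟨m, hmS, fun t ht => ?_⟩
          obtain ⟨r', rfl⟩ := hext t ht
          rw [← hcons] at hmq
          subst hmq
          cases r' with
          | nil =>
            rw [List.append_nil]
            exact (append_cons_lt _ _ _).le
          | cons n' r' =>
            rcases (hleast n' r' ht).eq_or_lt with rfl | hlt
            · exact hm _ ⟨ht, r', hcons r'⟩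
            · exact (append_cons_lt_append_cons _ _ _ hlt).le
        · obtain ⟨t, ht⟩ := hne
          have hall : ∀ t ∈ S, t = s := by
            intro t ht
            obtain ⟨r, rfl⟩ := hext t ht
            cases r with
            | nil => rw [List.append_nil]
            | cons n r => exact absurd ⟨n, r, ht⟩ hprop
          exact ⟨t, ht, fun t' ht' => le_of_eq (congrArg mk ((hall t ht).trans (hall t' ht').symm))⟩
    refine ⟨WellFounded.wellFounded_iff_has_min.2 fun S hS => ?_⟩
    obtain ⟨m, ⟨m', hm', rfl⟩, hm⟩ := hmin [] hacc ((fun s => s.1.toList) '' S) (by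
      rintro _ ⟨t, -, rfl⟩
      exact t.2) (hS.image _) (fun t _ => ⟨t, rfl⟩)
    exact ⟨m', hm', fun t ht => not_lt.2 (hm t.1.toList ⟨t, ht, rfl⟩)⟩

end KleeneBrouwer

/-! ### Hardness -/

namespace Lin

open TopologicalSpace

/-- A family of trees that depends continuously on a parameter gives rise to a continuous family
of linear orders. -/
theorem exists_continuous_mem_WO_iff {X : Type*} [TopologicalSpace X] (T : X → Set (List ℕ))
    (h0 : ∀ x, [] ∈ T x) (hT : ∀ x s t, s ++ t ∈ T x → s ∈ T x)
    (hclopen : ∀ s, IsClopen {x | s ∈ T x}) :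
    ∃ f : X → Lin, Continuous f ∧
      ∀ x, f x ∈ WO ↔ ¬ ∃ y : ℕ → ℕ, ∀ n, (List.range n).map y ∈ T x := by
  have hne : ∀ x, Nonempty {s : KleeneBrouwer // s.toList ∈ T x} := fun x => ⟨⟨⟨[]⟩, h0 x⟩⟩
  have hinj : ∀ x, Function.Injective fun s : {s : KleeneBrouwer // s.toList ∈ T x} =>
      Encodable.encode s.1.toList := by
    rintro x ⟨⟨s⟩, hs⟩ ⟨⟨t⟩, ht⟩ h
    obtain rfl : s = t := Encodable.encode_injective h
    rfl
  refine ⟨fun x => ofInjective _ (hinj x), ?_, fun x => ?_⟩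
  · rw [continuous_iff]
    intro m n
    by_cases hmn : (∃ s : List ℕ, Encodable.encode s = m) ∧ ∃ t : List ℕ, Encodable.encode t = n
    · obtain ⟨⟨s, rfl⟩, t, rfl⟩ := hmn
      convert (hclopen s).setOf_and ((hclopen t).setOf_and
        (.setOf_const (KleeneBrouwer.mk s ≤ KleeneBrouwer.mk t))) using 1
      ext x
      refine (ofInjective_apply _ (hinj x) _ _).trans ⟨?_, ?_⟩
      · rintro ⟨a, b, ha, hb, hab⟩
        obtain rfl : a.1.toList = s := Encodable.encode_injective ha
        obtain rfl : b.1.toList = t := Encodable.encode_injective hb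
        exact ⟨a.2, b.2, hab⟩
      · rintro ⟨ha, hb, hab⟩
        exact ⟨⟨⟨s⟩, ha⟩, ⟨⟨t⟩, hb⟩, rfl, rfl, hab⟩
    · convert isClopen_empty
      refine Set.eq_empty_of_forall_notMem fun x hx => hmn ?_
      obtain ⟨a, b, ha, hb, -⟩ := (ofInjective_apply _ (hinj x) m n).1 hx
      exact ⟨⟨_, ha⟩, _, hb⟩
  · rw [← KleeneBrouwer.wellFoundedLT_iff _ (h0 x) (hT x)]
    have e := ofInjectiveIso _ (hinj x)
    exact ⟨fun h => ⟨(e.symm.toOrderEmbedding.ltEmbedding.wellFounded h.wf)⟩,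
      fun h => ⟨(e.toOrderEmbedding.ltEmbedding.wellFounded h.wf)⟩⟩

theorem mem_WO_one : one ∈ WO :=
  ⟨(ofInjectiveIso _ _).toOrderEmbedding.ltEmbedding.wellFounded wellFounded_lt⟩

/-- Analytic subsets of zero-dimensional Polish spaces reduce continuously to the set of
ill-founded orders. -/
theorem exists_continuous_of_analyticSet {X : Type*} [TopologicalSpace X] [T1Space X]
    [SecondCountableTopology X] (hX : IsTopologicalBasis {U : Set X | IsClopen U}) {A : Set X}
    (hA : MeasureTheory.AnalyticSet A) :
    ∃ f : X → Lin, Continuous f ∧ ∀ x, f x ∈ WO ↔ x ∉ A := by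
  rw [MeasureTheory.AnalyticSet] at hA
  rcases hA with rfl | ⟨F, hF, rfl⟩
  · exact ⟨fun _ => one, continuous_const, fun x => iff_of_true mem_WO_one (Set.notMem_empty x)⟩
  obtain ⟨B, hBsub, hBc, hB⟩ := hX.exists_countable
  -- Adding the whole space makes the family non-empty, so that `ℕ` enumerates it.
  obtain ⟨U, hU⟩ := (hBc.insert Set.univ).exists_eq_range (Set.insert_nonempty _ _)
  have hUc : ∀ i, IsClopen (U i) := by
    intro i
    have : U i ∈ insert Set.univ B := hU ▸ Set.mem_range_self i
    rcases this with h | h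
    · rw [h]; exact isClopen_univ
    · exact hBsub h
  have hUi : ∀ x (V : Set X), IsOpen V → x ∈ V → ∃ i, x ∈ U i ∧ U i ⊆ V := by
    intro x V hV hx
    obtain ⟨W, hW, hxW, hWV⟩ := hB.exists_subset_of_mem_open hx hV
    obtain ⟨i, rfl⟩ : W ∈ Set.range U := hU ▸ Set.mem_insert_of_mem _ hW
    exact ⟨i, hxW, hWV⟩
  let C : List ℕ → Set (ℕ → ℕ) := fun s => {z | (List.range s.length).map z = s}
  have hC : ∀ y z n, z ∈ C ((List.range n).map y) ↔ ∀ i < n, z i = y i := by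
    intro y z n
    simp [C, List.map_inj_left]
  have hCmono : ∀ s t, C (s ++ t) ⊆ C s := by
    intro s t z hz
    have h : (List.range (s ++ t).length).map z = s ++ t := hz
    rw [List.length_append, List.range_add, List.map_append] at h
    exact (List.append_inj h (by simp)).1
  -- A sequence stays in the tree as long as its cylinder does not yet exclude, by one of the first
  -- `s.length` clopen sets, that `F` takes the value `x` there. The bound on `i` leaves finitely
  -- many conditions, so membership is clopen in `x`.
  let T : X → Set (List ℕ) := fun x =>
    {s | ∀ i ∈ Finset.range s.length, F '' C s ⊆ U i → x ∈ U i}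
  obtain ⟨f, hf, hfT⟩ := exists_continuous_mem_WO_iff T (fun x i hi => by simp at hi)
    (fun x s t hst i hi hs => hst i
      (Finset.mem_range.2 ((Finset.mem_range.1 hi).trans_le (by simp)))
      ((Set.image_mono (hCmono s t)).trans hs))
    (fun s => .setOf_forall_mem _ fun i _ => .setOf_imp (.setOf_const _) (hUc i))
  refine ⟨f, hf, fun x => (hfT x).trans (not_congr ⟨?_, ?_⟩)⟩
  · rintro ⟨y, hy⟩
    refine ⟨y, by_contra fun hne => ?_⟩
    obtain ⟨i, hyi, hi⟩ := hUi (F y) {x}ᶜ isOpen_compl_singleton hne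
    obtain ⟨_, ⟨y', n, rfl⟩, hyn, hn⟩ := (PiNat.isTopologicalBasis_cylinders
      (fun _ : ℕ => ℕ)).exists_subset_of_mem_open (show y ∈ F ⁻¹' U i from hyi)
      ((hUc i).isOpen.preimage hF)
    -- Length `n` puts the image of the cylinder inside `U i`; length `i + 1` ensures that `U i` is
    -- tested.
    refine hi (hy (max n (i + 1)) i (by simp) ?_) rfl
    rintro _ ⟨z, hz, rfl⟩
    rw [hC] at hz
    exact hn fun j hj => (hz j (hj.trans_le (le_max_left _ _))).trans (hyn j hj)
  · rintro ⟨y, rfl⟩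
    exact ⟨y, fun n i _ hi => hi ⟨y, (hC y y n).2 fun _ _ => rfl, rfl⟩⟩

/-- The pairs of orders of which the first is ill-founded or the second is well-founded form a hard
set for the unions of an analytic and a coanalytic set. -/
theorem isHard_not_mem_WO_or_mem_WO :
    IsHardForAnalyticUnionCoanalytic.{u} {p : Lin × Lin | p.1 ∉ WO ∨ p.2 ∈ WO} := by
  rintro X _ _ hX B ⟨B₀, B₁, h₀, h₁, rfl⟩
  obtain ⟨f, hf, hfB⟩ := exists_continuous_of_analyticSet hX h₀
  obtain ⟨g, hg, hgB⟩ := exists_continuous_of_analyticSet hX h₁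
  refine ⟨fun x => (f x, g x), hf.prodMk hg, ?_⟩
  ext x
  change f x ∉ WO ∨ g x ∈ WO ↔ x ∈ B₀ ∨ x ∈ B₁
  rw [hfB, hgB, not_not, Set.notMem_compl_iff]

end Lin

theorem IsHardForAnalyticUnionCoanalytic.of_preimage {Y Z : Type v} [TopologicalSpace Y]
    [TopologicalSpace Z] {S : Set Z} {r : Y → Z} (hr : Continuous r)
    (h : IsHardForAnalyticUnionCoanalytic.{u} (r ⁻¹' S)) :
    IsHardForAnalyticUnionCoanalytic.{u} S := by
  intro X _ _ hX B hB
  obtain ⟨f, hf, hfB⟩ := h X hX B hB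
  exact ⟨r ∘ f, hr.comp hf, hfB⟩

theorem mainTheorem4 :
    IsHardForAnalyticUnionCoanalytic.{u} Lin.StS ∧
    IsHardForAnalyticUnionCoanalytic.{u} {p : Lin × Lin | p.1 ∉ Lin.WO ∨ p.2 ∈ Lin.WO} ∧
    (∀ K : Lin, Nonempty (K.zetaPow.Carrier ≃o IntPow K.Carrier)) ∧
    (∀ K L : Lin, Nonempty ((Lin.reduction (K, L)).Carrier ≃o
      ℕ ×ₗ ((Unit ⊕ₗ L.Carrier) ×ₗ IntPow K.Carrier))) ∧
    Continuous Lin.reduction ∧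
    Lin.reduction ⁻¹' Lin.StS = {p : Lin × Lin | p.1 ∉ Lin.WO ∨ p.2 ∈ Lin.WO} := by
  refine ⟨?_, Lin.isHard_not_mem_WO_or_mem_WO, fun K => ⟨K.zetaPowIso⟩,
    fun K L => ⟨Lin.reductionIso K L⟩, Lin.continuous_reduction, Lin.reduction_preimage_StS⟩
  refine IsHardForAnalyticUnionCoanalytic.of_preimage Lin.continuous_reduction ?_
  rw [Lin.reduction_preimage_StS]
  exact Lin.isHard_not_mem_WO_or_mem_WO
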